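/- Let $(M,J,g)$ be an almost Norden manifold, i.e. a smooth $2n$-dimensional manifold with an almost complex structure $J$ and a pseudo-Riemannian metric $g$ such that $g(JX,JY)=-g(X,Y)$; let $\nabla$ be the Levi-Civita connection of $g$ and $R(X,Y)Z=\nabla_X\nabla_YZ-\nabla_Y\nabla_XZ-\nabla_{[X,Y]}Z$ its curvature. Denote by $X^H,X^V$ the horizontal (with respect to $\nabla$) and vertical lifts to $TM$. Let $\hat g$ be the complete lift of $g$ to $TM$, given by $\hat g(X^H,Y^H)=\hat g(X^V,Y^V)=0$ and $\hat g(X^H,Y^V)=\hat g(X^V,Y^H)=g(X,Y)$, and let $J_1X^H=-(JX)^H$, $J_1X^V=(JX)^V$, $J_2X^H=X^V$, $J_2X^V=-X^H$, $J_3=J_1J_2$. For a non-degenerate plane with basis $x,y$ write $\pi_1(x,y,y,x)=g(x,x)g(y,y)-g(x,y)^2$, $k(x,y)=g(R(x,y)y,x)/\pi_1(x,y,y,x)$ and $(\nabla_uk)(x,y)=g((\nabla_uR)(x,y)y,x)/\pi_1(x,y,y,x)$, and let $\hat k$ denote the sectional curvature of $\hat g$. A plane $\beta$ is $J_\alpha$-holomorphic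 if $J_\alpha\beta=\beta$. Let $p\in M$, $u\in T_pM$, and let $\{e_i,e_{\bar i}\}_{i=1}^n$ be a basis of $T_pM$ with $e_{\bar i}=Je_i$ which is orthonormal for $g$ (the vectors are mutually orthogonal and $g(e_a,e_a)=\pm1$). For $a\in\{1,\dots,n,\bar1,\dots,\bar n\}$ put $\xi_a=\frac1{\sqrt2}(e_a^H+e_a^V)$ and $\eta_a=\frac1{\sqrt2}(e_a^H-e_a^V)$ in $T_u(TM)$; the planes spanned by two distinct vectors of $\{\xi_a,\eta_a\}$ are called basic. Then every basic plane is non-degenerate with respect to $\hat g$, and: (i) for all $a\neq b$, $$\hat k(\xi_a,\xi_b)=\tfrac14(\nabla_uk)(e_a,e_b)+k(e_a,e_b),\quad \hat k(\xi_a,\eta_b)=-\tfrac14(\nabla_uk)(e_a,e_b),\quad \hat k(\eta_a,\eta_b)=\tfrac14(\nabla_uk)(e_a,e_b)-k(e_a,e_b);$$ (ii) the $J_1$-holomorphic basic planes are exactly $\{\xi_{\bar i},\eta_i\}$ and $\{\eta_{\bar i},\xi_i\}$, $1\le i\le n$, and for each $i$ they have equal sectional curvatures, $\hat k(\xi_{\bar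 i},\eta_i)=\hat k(\eta_{\bar i},\xi_i)$; (iii) the $J_2$-holomorphic basic planes are exactly $\{\eta_i,\xi_i\}$ and $\{\eta_{\bar i},\xi_{\bar i}\}$, $1\le i\le n$, and their sectional curvatures vanish. -/

import Mathlib

open scoped Manifold ContDiff
open Bundle

noncomputable section

namespace Norden

/-! ### Pseudo-Riemannian geometry in a coordinate domain

`G : E → E →L[ℝ] E →L[ℝ] ℝ` is the coordinate expression of a metric. -/

section Coordinates

variable {E : Type*} [NormedAddCommGroup E] [NormedSpace ℝ E]

/-- The trilinear form `(v, w, z) ↦ D z v w`. -/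
def cycle (D : E →L[ℝ] E →L[ℝ] E →L[ℝ] ℝ) : E →L[ℝ] E →L[ℝ] E →L[ℝ] ℝ :=
  ((ContinuousLinearMap.flipₗᵢ ℝ E E ℝ : (E →L[ℝ] E →L[ℝ] ℝ) ≃ₗᵢ[ℝ] (E →L[ℝ] E →L[ℝ] ℝ)) :
    (E →L[ℝ] E →L[ℝ] ℝ) →L[ℝ] (E →L[ℝ] E →L[ℝ] ℝ)) ∘L D.flip

theorem cycle_apply (D : E →L[ℝ] E →L[ℝ] E →L[ℝ] ℝ) (v w z : E) : cycle D v w z = D z v w := rfl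

set_option maxSynthPendingDepth 3 in
/-- The Christoffel symbols of the first kind of `G` at `y`:
`(v, w, z) ↦ (1/2) (∂_v G(w,z) + ∂_w G(v,z) - ∂_z G(v,w))`. -/
def christoffelFirst (G : E → E →L[ℝ] E →L[ℝ] ℝ) (y : E) : E →L[ℝ] E →L[ℝ] E →L[ℝ] ℝ :=
  (1 / 2 : ℝ) • (fderiv ℝ G y + (fderiv ℝ G y).flip - cycle (fderiv ℝ G y))

set_option maxSynthPendingDepth 3 in
theorem christoffelFirst_apply (G : E → E →L[ℝ] E →L[ℝ] ℝ) (y v w z : E) :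
    christoffelFirst G y v w z =
      (1 / 2) * (fderiv ℝ G y v w z + fderiv ℝ G y w v z - fderiv ℝ G y z v w) := by
  simp [christoffelFirst, cycle_apply]

/-- The Christoffel symbols of the second kind of `G` at `y`, that is, the Levi-Civita connection
in coordinates: `christoffel G y v w` is the covariant derivative along `v` of the constant field
`w`. The first symbols are raised with the inverse of `G y : E →L[ℝ] (E →L[ℝ] ℝ)`. -/
def christoffel (G : E → E →L[ℝ] E →L[ℝ] ℝ) (y : E) : E →L[ℝ] E →L[ℝ] E :=
  (ContinuousLinearMap.compL ℝ E (E →L[ℝ] ℝ) E (G y).inverse) ∘L christoffelFirst G y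

theorem christoffel_apply (G : E → E →L[ℝ] E →L[ℝ] ℝ) (y v w : E) :
    christoffel G y v w = (G y).inverse (christoffelFirst G y v w) := rfl

/-- The curvature `R(a,b)c = ∇_a ∇_b c - ∇_b ∇_a c - ∇_[a,b] c` of the Levi-Civita connection of
`G` in coordinates (`a`, `b`, `c` are constant fields, so that `[a,b] = 0`). -/
def riemann (G : E → E →L[ℝ] E →L[ℝ] ℝ) (y a b c : E) : E :=
  fderiv ℝ (fun y' => christoffel G y' b c) y a - fderiv ℝ (fun y' => christoffel G y' a c) y b
    + christoffel G y a (christoffel G y b c) - christoffel G y b (christoffel G y a c)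

/-- The covariant derivative `(∇_u R)(a,b)c` of the curvature tensor in coordinates. -/
def nablaRiemann (G : E → E →L[ℝ] E →L[ℝ] ℝ) (y u a b c : E) : E :=
  fderiv ℝ (fun y' => riemann G y' a b c) y u + christoffel G y u (riemann G y a b c)
    - riemann G y (christoffel G y u a) b c - riemann G y a (christoffel G y u b) c
    - riemann G y a b (christoffel G y u c)

end Coordinates

/-- The bilinear form `(v, w) ↦ B (S v) (T w)`. -/
def pullForm {V W : Type*} [AddCommGroup V] [Module ℝ V] [TopologicalSpace V]
    [IsTopologicalAddGroup V] [ContinuousSMul ℝ V] [AddCommGroup W] [Module ℝ W]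
    [TopologicalSpace W] [IsTopologicalAddGroup W] [ContinuousSMul ℝ W]
    (B : W →L[ℝ] W →L[ℝ] ℝ) (S T : V →L[ℝ] W) : V →L[ℝ] V →L[ℝ] ℝ :=
  ContinuousLinearMap.precomp ℝ T ∘L B ∘L S

/-! ### Pseudo-Riemannian geometry on a manifold -/

section Manifold

variable {E : Type*} [NormedAddCommGroup E] [NormedSpace ℝ E]
  {H : Type*} [TopologicalSpace H] (I : ModelWithCorners ℝ E H)
  (M : Type*) [TopologicalSpace M] [ChartedSpace H M]

/-- A field of bilinear forms on the tangent spaces of `M`. -/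
abbrev FormField : Type _ := ∀ x : M, TangentSpace I x →L[ℝ] TangentSpace I x →L[ℝ] ℝ

/-- A field of endomorphisms of the tangent spaces of `M`. -/
abbrev EndField : Type _ := ∀ x : M, TangentSpace I x →L[ℝ] TangentSpace I x

/-- A smooth pseudo-Riemannian metric. -/
structure IsPseudoRiemannianMetric [IsManifold I ∞ M] (g : FormField I M) : Prop where
  symm : ∀ (x : M) (v w : TangentSpace I x), g x v w = g x w v
  nondegenerate : ∀ (x : M) (v : TangentSpace I x), (∀ w : TangentSpace I x, g x v w = 0) → v = 0
  contMDiff : ContMDiff I (I.prod 𝓘(ℝ, E →L[ℝ] E →L[ℝ] ℝ)) ∞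
    (fun x => TotalSpace.mk' (E →L[ℝ] E →L[ℝ] ℝ) (E := fun x : M =>
      TangentSpace I x →L[ℝ] TangentSpace I x →L[ℝ] ℝ) x (g x))

/-- A smooth almost complex structure. -/
structure IsAlmostComplexStructure [IsManifold I ∞ M] (J : EndField I M) : Prop where
  sq : ∀ (x : M) (v : TangentSpace I x), J x (J x v) = -v
  contMDiff : ContMDiff I (I.prod 𝓘(ℝ, E →L[ℝ] E)) ∞
    (fun x => TotalSpace.mk' (E →L[ℝ] E) (E := fun x : M =>
      TangentSpace I x →L[ℝ] TangentSpace I x) x (J x))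

/-- `(M, J, g)` is an almost Norden manifold: `J` acts as an anti-isometry of `g`. -/
structure IsAlmostNorden [IsManifold I ∞ M] (J : EndField I M) (g : FormField I M) : Prop where
  metric : IsPseudoRiemannianMetric I M g
  almostComplex : IsAlmostComplexStructure I M J
  antiIsometry : ∀ (x : M) (v w : TangentSpace I x), g x (J x v) (J x w) = -g x v w

variable {I M} [IsManifold I 1 M]

/-- The components of `g` in the preferred chart at `x₀`, as a function on the model space. -/
def inChart (g : FormField I M) (x₀ : M) (y : E) : E →L[ℝ] E →L[ℝ] ℝ :=
  pullForm (g ((extChartAt I x₀).symm y))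
    ((trivializationAt E (TangentSpace I : M → Type _) x₀).symmL ℝ ((extChartAt I x₀).symm y))
    ((trivializationAt E (TangentSpace I : M → Type _) x₀).symmL ℝ ((extChartAt I x₀).symm y))

/-- The Christoffel symbols of `g` at `x` in the preferred chart at `x`. (In Mathlib
`TangentSpace I x` is the model space `E`, identified through the preferred chart at `x`.) -/
def christoffelAt (g : FormField I M) (x : M) :
    TangentSpace I x →L[ℝ] TangentSpace I x →L[ℝ] TangentSpace I x :=
  christoffel (E := E) (inChart g x) (extChartAt I x x)

/-- The curvature tensor `R(a,b)c` of the Levi-Civita connection of `g` at `x`. -/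
def curvature (g : FormField I M) (x : M) (a b c : TangentSpace I x) : TangentSpace I x :=
  riemann (E := E) (inChart g x) (extChartAt I x x) a b c

/-- The covariant derivative `(∇_u R)(a,b)c` at `x`. -/
def nablaCurvature (g : FormField I M) (x : M) (u a b c : TangentSpace I x) : TangentSpace I x :=
  nablaRiemann (E := E) (inChart g x) (extChartAt I x x) u a b c

/-- `π₁(a,b,b,a) = g(a,a) g(b,b) - g(a,b)²`; the plane spanned by `a`, `b` is non-degenerate if
and only if this is non-zero. -/
def gram (g : FormField I M) (x : M) (a b : TangentSpace I x) : ℝ :=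
  g x b b * g x a a - g x a b * g x b a

/-- The sectional curvature `R(a,b,b,a) / π₁(a,b,b,a)` of the plane spanned by `a`, `b`, where
`R(a,b,c,d) = g(R(a,b)c,d)`. -/
def sectional (g : FormField I M) (x : M) (a b : TangentSpace I x) : ℝ :=
  g x (curvature g x a b b) a / gram g x a b

/-- `∇_u k`, the covariant derivative of the sectional curvature:
`(∇_u R)(a,b,b,a) / π₁(a,b,b,a)` (recall `∇ π₁ = 0`). -/
def nablaSectional (g : FormField I M) (x : M) (u a b : TangentSpace I x) : ℝ :=
  g x (nablaCurvature g x u a b b) a / gram g x a b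

end Manifold

/-- A subspace `β` is `J`-holomorphic if `J β = β`. -/
def IsHolomorphic {V : Type*} [AddCommGroup V] [Module ℝ V] [TopologicalSpace V]
    (J : V →L[ℝ] V) (β : Submodule ℝ V) : Prop :=
  β.map (J : V →ₗ[ℝ] V) = β

/-! ### The tangent bundle

The preferred chart of `TM` at `u ∈ T_pM` is the one induced by the preferred chart of `M` at `p`,
so that `T_u(TM)` is `E × E`: base components first, fibre components second. -/

section TangentBundle

variable {E : Type*} [NormedAddCommGroup E] [NormedSpace ℝ E]
  {H : Type*} [TopologicalSpace H] {I : ModelWithCorners ℝ E H}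
  {M : Type*} [TopologicalSpace M] [ChartedSpace H M] [IsManifold I 1 M]

/-- The differential of the projection `TM → M` at `u`. -/
def dproj (u : TangentBundle I M) : TangentSpace I.tangent u →L[ℝ] TangentSpace I u.proj :=
  ContinuousLinearMap.fst ℝ E E

/-- The vertical lift `X ↦ X^V = X^k ∂/∂y^k` at `u`. -/
def vLift (u : TangentBundle I M) : TangentSpace I u.proj →L[ℝ] TangentSpace I.tangent u :=
  ContinuousLinearMap.inr ℝ E E

/-- The field `X^k ∂/∂x^k` at `u`. -/
def baseLift (u : TangentBundle I M) : TangentSpace I u.proj →L[ℝ] TangentSpace I.tangent u :=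
  ContinuousLinearMap.inl ℝ E E

/-- The components `ξ ↦ (dy^k(ξ))_k` of `ξ ∈ T_u(TM)`. -/
def fibrePart (u : TangentBundle I M) : TangentSpace I.tangent u →L[ℝ] TangentSpace I u.proj :=
  ContinuousLinearMap.snd ℝ E E

/-- The horizontal lift `X ↦ X^H = X^k ∂/∂x^k - Γ^k_{ij} u^i X^j ∂/∂y^k` at `u` with respect to the
Levi-Civita connection of `g`. -/
def hLift (g : FormField I M) (u : TangentBundle I M) :
    TangentSpace I u.proj →L[ℝ] TangentSpace I.tangent u :=
  baseLift u - vLift u ∘L christoffelAt g u.proj u.snd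

/-- The connection map at `u`, characterized by `ξ = (dproj ξ)^H + (connector ξ)^V`. -/
def connector (g : FormField I M) (u : TangentBundle I M) :
    TangentSpace I.tangent u →L[ℝ] TangentSpace I u.proj :=
  fibrePart u + christoffelAt g u.proj u.snd ∘L dproj u

theorem dproj_hLift (g : FormField I M) (u : TangentBundle I M) (X : TangentSpace I u.proj) :
    dproj u (hLift g u X) = X := by
  have h₁ : dproj u (baseLift u X) = X := rfl
  have h₂ : dproj u (vLift u (christoffelAt g u.proj u.snd X)) = 0 := rfl
  simp [hLift, h₁, h₂]

theorem dproj_vLift (u : TangentBundle I M) (X : TangentSpace I u.proj) :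
    dproj u (vLift u X) = 0 := rfl

theorem connector_hLift (g : FormField I M) (u : TangentBundle I M) (X : TangentSpace I u.proj) :
    connector g u (hLift g u X) = 0 := by
  have h₁ : fibrePart u (baseLift u X) = 0 := rfl
  have h₂ : fibrePart u (vLift u (christoffelAt g u.proj u.snd X)) =
    christoffelAt g u.proj u.snd X := rfl
  have h₃ : connector g u (hLift g u X) = fibrePart u (hLift g u X) +
    christoffelAt g u.proj u.snd (dproj u (hLift g u X)) := rfl
  rw [h₃, dproj_hLift]
  simp [hLift, h₁, h₂]

theorem connector_vLift (g : FormField I M) (u : TangentBundle I M) (X : TangentSpace I u.proj) :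
    connector g u (vLift u X) = X := by
  have h₁ : fibrePart u (vLift u X) = X := rfl
  simp [connector, h₁, dproj_vLift]

theorem hLift_dproj_add_vLift_connector (g : FormField I M) (u : TangentBundle I M)
    (ξ : TangentSpace I.tangent u) :
    hLift g u (dproj u ξ) + vLift u (connector g u ξ) = ξ := by
  have h : baseLift u (dproj u ξ) + vLift u (fibrePart u ξ) = ξ :=
    Prod.ext (add_zero (ξ : E × E).1) (zero_add (ξ : E × E).2)
  have h₂ : hLift g u (dproj u ξ) = baseLift u (dproj u ξ) -
    vLift u (christoffelAt g u.proj u.snd (dproj u ξ)) := rfl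
  have h₃ : connector g u ξ = fibrePart u ξ + christoffelAt g u.proj u.snd (dproj u ξ) := rfl
  rw [h₂, h₃, map_add]
  refine Eq.trans ?_ h
  abel

/-- The complete lift metric `ĝ` on `TM`: the lifts satisfy `ĝ(X^H,Y^H) = ĝ(X^V,Y^V) = 0` and
`ĝ(X^H,Y^V) = ĝ(X^V,Y^H) = g(X,Y)`. -/
def completeLift (g : FormField I M) : FormField I.tangent (TangentBundle I M) := fun u =>
  pullForm (g u.proj) (dproj u) (connector g u) + pullForm (g u.proj) (connector g u) (dproj u)

theorem completeLift_apply (g : FormField I M) (u : TangentBundle I M)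
    (ξ ζ : TangentSpace I.tangent u) : completeLift g u ξ ζ =
      g u.proj (dproj u ξ) (connector g u ζ) + g u.proj (connector g u ξ) (dproj u ζ) := rfl

theorem completeLift_hLift_vLift (g : FormField I M) (u : TangentBundle I M)
    (X Y : TangentSpace I u.proj) : completeLift g u (hLift g u X) (vLift u Y) = g u.proj X Y := by
  simp [completeLift_apply, dproj_hLift, dproj_vLift, connector_hLift, connector_vLift]

theorem completeLift_vLift_hLift (g : FormField I M) (u : TangentBundle I M)
    (X Y : TangentSpace I u.proj) : completeLift g u (vLift u X) (hLift g u Y) = g u.proj X Y := by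
  simp [completeLift_apply, dproj_hLift, dproj_vLift, connector_hLift, connector_vLift]

theorem completeLift_hLift_hLift (g : FormField I M) (u : TangentBundle I M)
    (X Y : TangentSpace I u.proj) : completeLift g u (hLift g u X) (hLift g u Y) = 0 := by
  simp [completeLift_apply, connector_hLift]

theorem completeLift_vLift_vLift (g : FormField I M) (u : TangentBundle I M)
    (X Y : TangentSpace I u.proj) : completeLift g u (vLift u X) (vLift u Y) = 0 := by
  simp [completeLift_apply, dproj_vLift]

/-- `J₁ : X^H ↦ -(JX)^H, X^V ↦ (JX)^V`. -/
def J₁ (J : EndField I M) (g : FormField I M) : EndField I.tangent (TangentBundle I M) := fun u =>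
  -(hLift g u ∘L J u.proj ∘L dproj u) + vLift u ∘L J u.proj ∘L connector g u

/-- `J₂ : X^H ↦ X^V, X^V ↦ -X^H`. -/
def J₂ (g : FormField I M) : EndField I.tangent (TangentBundle I M) := fun u =>
  vLift u ∘L dproj u - hLift g u ∘L connector g u

theorem J₁_lifts (J : EndField I M) (g : FormField I M) (u : TangentBundle I M)
    (X : TangentSpace I u.proj) :
    J₁ J g u (hLift g u X) = -hLift g u (J u.proj X) ∧
      J₁ J g u (vLift u X) = vLift u (J u.proj X) := by
  simp [J₁, dproj_hLift, dproj_vLift, connector_hLift, connector_vLift]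

theorem J₂_lifts (g : FormField I M) (u : TangentBundle I M) (X : TangentSpace I u.proj) :
    J₂ g u (hLift g u X) = vLift u X ∧ J₂ g u (vLift u X) = -hLift g u X := by
  simp [J₂, dproj_hLift, dproj_vLift, connector_hLift, connector_vLift]

/-- `J₃ : X^H ↦ (JX)^V, X^V ↦ (JX)^H`. -/
def J₃ (J : EndField I M) (g : FormField I M) : EndField I.tangent (TangentBundle I M) := fun u =>
  vLift u ∘L J u.proj ∘L dproj u + hLift g u ∘L J u.proj ∘L connector g u

theorem J₃_lifts (J : EndField I M) (g : FormField I M) (u : TangentBundle I M)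
    (X : TangentSpace I u.proj) :
    J₃ J g u (hLift g u X) = vLift u (J u.proj X) ∧
      J₃ J g u (vLift u X) = hLift g u (J u.proj X) := by
  simp [J₃, dproj_hLift, dproj_vLift, connector_hLift, connector_vLift]

/-- An orthonormal `J`-basis of `T_pM`: `e (inl i) = e_i` and `e (inr i) = e_{ī} = J e_i`. -/
structure IsOrthonormalJBasis {n : ℕ} (J : EndField I M) (g : FormField I M) (p : M)
    (e : Module.Basis (Fin n ⊕ Fin n) ℝ (TangentSpace I p)) : Prop where
  bar : ∀ i, e (Sum.inr i) = J p (e (Sum.inl i))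
  orthogonal : ∀ a b, a ≠ b → g p (e a) (e b) = 0
  normalized : ∀ a, g p (e a) (e a) = 1 ∨ g p (e a) (e a) = -1

/-- `ξ = (X^H + X^V) / √2`. -/
def xi (g : FormField I M) (u : TangentBundle I M) (X : TangentSpace I u.proj) :
    TangentSpace I.tangent u :=
  (1 / √2 : ℝ) • (hLift g u X + vLift u X)

/-- `η = (X^H - X^V) / √2`. -/
def eta (g : FormField I M) (u : TangentBundle I M) (X : TangentSpace I u.proj) :
    TangentSpace I.tangent u :=
  (1 / √2 : ℝ) • (hLift g u X - vLift u X)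

/-- The adapted `H`-basis of `T_u(TM)`: `inl a ↦ ξ_a`, `inr a ↦ η_a`, where the index `a` is
`inl i` for `i` and `inr i` for `ī`. -/
def adapted {n : ℕ} (g : FormField I M) (u : TangentBundle I M)
    (e : Module.Basis (Fin n ⊕ Fin n) ℝ (TangentSpace I u.proj)) :
    (Fin n ⊕ Fin n) ⊕ (Fin n ⊕ Fin n) → TangentSpace I.tangent u :=
  Sum.elim (fun a => xi g u (e a)) (fun a => eta g u (e a))

/-- The basic 2-plane spanned by the vectors of the adapted `H`-basis with indices `A`, `B`. -/
def basicPlane {n : ℕ} (g : FormField I M) (u : TangentBundle I M)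
    (e : Module.Basis (Fin n ⊕ Fin n) ℝ (TangentSpace I u.proj))
    (A B : (Fin n ⊕ Fin n) ⊕ (Fin n ⊕ Fin n)) : Submodule ℝ (TangentSpace I.tangent u) :=
  Submodule.span ℝ {adapted g u e A, adapted g u e B}

end TangentBundle

end Norden

end

/-!
The complete lift of a tensor field is its derivative in the direction of the fibre coordinate.
Since this derivative satisfies the Leibniz rule and commutes with partial derivatives, in the
coordinates of `TM` induced by a chart the Christoffel symbols and the curvature of the complete
lift of `g` are the complete lifts of the Christoffel symbols and of the curvature `R` of `g`.
Splitting the lifted curvature into horizontal and vertical parts turns the fibre derivative of `R`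
into `∇_u R`, and for the lifts `X^H + ε X^V`, `Y^H + δ Y^V` of orthogonal vectors the sectional
curvature becomes `(∇_u k / 4 + (ε + δ) k / 2) / (ε δ)`; `ξ` and `η` are the slopes `±1`.

Each `J_α` permutes the adapted basis, up to sign, by an involution without fixed points, so that a
basic plane is `J_α`-holomorphic exactly when its two basis vectors are exchanged.
-/

noncomputable section

set_option maxSynthPendingDepth 3

namespace Norden

theorem pullForm_apply {V W : Type*} [AddCommGroup V] [Module ℝ V] [TopologicalSpace V]
    [IsTopologicalAddGroup V] [ContinuousSMul ℝ V] [AddCommGroup W] [Module ℝ W]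
    [TopologicalSpace W] [IsTopologicalAddGroup W] [ContinuousSMul ℝ W]
    (B : W →L[ℝ] W →L[ℝ] ℝ) (S T : V →L[ℝ] W) (v w : V) :
    pullForm B S T v w = B (S v) (T w) := rfl

section TangentLift

variable {E F V W X Y : Type*} [NormedAddCommGroup E] [NormedSpace ℝ E]
  [NormedAddCommGroup F] [NormedSpace ℝ F] [NormedAddCommGroup V] [NormedSpace ℝ V]
  [NormedAddCommGroup W] [NormedSpace ℝ W] [NormedAddCommGroup X] [NormedSpace ℝ X]
  [NormedAddCommGroup Y] [NormedSpace ℝ Y]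

theorem fderiv_clm_apply_const₂ {B : E → V →L[ℝ] W →L[ℝ] X} {y : E}
    (hB : DifferentiableAt ℝ B y) (a : E) (v : V) (w : W) :
    fderiv ℝ (fun z => B z v w) y a = fderiv ℝ B y a v w := by
  rw [fderiv_clm_apply (by fun_prop) (by fun_prop), fderiv_clm_apply hB (by fun_prop)]
  simp

theorem fderiv_clm_apply_const₃ {T : E → V →L[ℝ] W →L[ℝ] X →L[ℝ] Y} {y : E}
    (hT : DifferentiableAt ℝ T y) (a : E) (v : V) (w : W) (x : X) :
    fderiv ℝ (fun z => T z v w x) y a = fderiv ℝ T y a v w x := by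
  rw [fderiv_clm_apply (by fun_prop) (by fun_prop), ← fderiv_clm_apply_const₂ hT]
  simp

theorem contDiffAt_clm_flip {n : ℕ∞ω} {B : E → V →L[ℝ] W →L[ℝ] X} {y : E}
    (hB : ContDiffAt ℝ n B y) : ContDiffAt ℝ n (fun z => (B z).flip) y :=
  (ContinuousLinearMap.flipₗᵢ ℝ V W X).toContinuousLinearEquiv.contDiff.contDiffAt.comp y hB

theorem fderiv_fderiv_comm {φ : E → F} {y : E} (hφ : ContDiffAt ℝ 2 φ y) (a b : E) :
    fderiv ℝ (fderiv ℝ φ) y a b = fderiv ℝ (fderiv ℝ φ) y b a :=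
  (hφ.isSymmSndFDerivAt (by simp)).eq a b

theorem differentiableAt_fderiv {φ : E → F} {y : E} (hφ : ContDiffAt ℝ 2 φ y) :
    DifferentiableAt ℝ (fderiv ℝ φ) y :=
  (hφ.fderiv_right (m := 1) (by norm_num)).differentiableAt (by simp)

/-- The tangent map of `φ`, as a map from `TE = E × E` to `TF = F × F`. -/
def tangentFun (φ : E → F) (q : E × E) : F × F := (φ q.1, fderiv ℝ φ q.1 q.2)

/-- The complete lift to `TE = E × E` of a field `B` of bilinear maps on `E`: the derivative at
`t = 0` of `B (y + t v) (a + t a') (b + t b')`, at the point `(y, v)` and on the vectors `(a, a')`,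
`(b, b')`. For bilinear forms it is the complete lift of Yano and Ishihara; for a field of
vector-valued maps it is the fibre part of the complete lift. -/
def bilinLift (B : E → V →L[ℝ] W →L[ℝ] X) (p : E × E) : V × V →L[ℝ] W × W →L[ℝ] X :=
  (fderiv ℝ B p.1 p.2).bilinearComp (.fst ℝ V V) (.fst ℝ W W)
    + (B p.1).bilinearComp (.snd ℝ V V) (.fst ℝ W W)
    + (B p.1).bilinearComp (.fst ℝ V V) (.snd ℝ W W)

/-- The complete lift to `TE = E × E` of a field of trilinear maps on `E`; see `bilinLift`. -/
def trilinLift (T : E → V →L[ℝ] W →L[ℝ] X →L[ℝ] Y) (p : E × E) (a : V × V) (b : W × W)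
    (c : X × X) : Y :=
  fderiv ℝ T p.1 p.2 a.1 b.1 c.1 + T p.1 a.2 b.1 c.1 + T p.1 a.1 b.2 c.1 + T p.1 a.1 b.1 c.2

theorem bilinLift_apply (B : E → V →L[ℝ] W →L[ℝ] X) (p : E × E) (a : V × V) (b : W × W) :
    bilinLift B p a b = fderiv ℝ B p.1 p.2 a.1 b.1 + B p.1 a.2 b.1 + B p.1 a.1 b.2 := rfl

theorem bilinLift_congr {B B' : E → V →L[ℝ] W →L[ℝ] X} {p : E × E} (h : B =ᶠ[nhds p.1] B') :
    bilinLift B p = bilinLift B' p := by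
  rw [bilinLift, bilinLift, h.fderiv_eq, h.eq_of_nhds]

theorem trilinLift_sub_flip {T : E → V →L[ℝ] V →L[ℝ] X →L[ℝ] Y} {p : E × E}
    (hT : DifferentiableAt ℝ T p.1) (a b : V × V) (c : X × X) :
    trilinLift (fun y => T y - (T y).flip) p a b c =
      trilinLift T p a b c - trilinLift T p b a c := by
  have hflip : HasFDerivAt (fun y => (T y).flip) _ p.1 :=
    (ContinuousLinearMap.flipₗᵢ ℝ V V (X →L[ℝ] Y)).toContinuousLinearEquiv.hasFDerivAt.comp p.1
      hT.hasFDerivAt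
  simp only [trilinLift, (hT.hasFDerivAt.fun_sub hflip).fderiv]
  simp only [sub_apply, ContinuousLinearMap.comp_apply, ContinuousLinearEquiv.coe_coe,
    LinearIsometryEquiv.coe_toContinuousLinearEquiv, ContinuousLinearMap.coe_flipₗᵢ,
    ContinuousLinearMap.flip_apply]
  abel

theorem hasFDerivAt_fderiv_apply {φ : E → F} {p : E × E}
    (hφ : DifferentiableAt ℝ (fderiv ℝ φ) p.1) :
    HasFDerivAt (fun q : E × E => fderiv ℝ φ q.1 q.2)
      (fderiv ℝ φ p.1 ∘L .snd ℝ E E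
        + (fderiv ℝ (fderiv ℝ φ) p.1 ∘L .fst ℝ E E).flip p.2) p :=
  (hφ.hasFDerivAt.comp p hasFDerivAt_fst).clm_apply hasFDerivAt_snd

theorem fderiv_tangentFun {φ : E → F} {p : E × E} (hφ : ContDiffAt ℝ 2 φ p.1) (a : E × E) :
    fderiv ℝ (tangentFun φ) p a =
      (fderiv ℝ φ p.1 a.1, fderiv ℝ (fderiv ℝ φ) p.1 p.2 a.1 + fderiv ℝ φ p.1 a.2) := by
  have hbase : HasFDerivAt (fun q : E × E => φ q.1) (fderiv ℝ φ p.1 ∘L .fst ℝ E E) p :=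
    (hφ.differentiableAt (by simp)).hasFDerivAt.comp p hasFDerivAt_fst
  have htangent : HasFDerivAt (tangentFun φ) _ p :=
    hbase.prodMk (hasFDerivAt_fderiv_apply (differentiableAt_fderiv hφ))
  rw [htangent.fderiv, fderiv_fderiv_comm hφ p.2 a.1]
  simp [add_comm]

theorem contDiffAt_bilinLift {m n : ℕ∞ω} {B : E → V →L[ℝ] W →L[ℝ] X} {p : E × E}
    (hB : ContDiffAt ℝ n B p.1) (hmn : m + 1 ≤ n) : ContDiffAt ℝ m (bilinLift B) p := by
  have hcomp {D : E × E → V →L[ℝ] W →L[ℝ] X} (hD : ContDiffAt ℝ m D p)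
      (S : V × V →L[ℝ] V) (T : W × W →L[ℝ] W) :
      ContDiffAt ℝ m (fun q => (D q).bilinearComp S T) p :=
    contDiffAt_clm_flip ((contDiffAt_clm_flip (hD.clm_comp contDiffAt_const)).clm_comp
      contDiffAt_const)
  have hbase : ContDiffAt ℝ m (fun q : E × E => B q.1) p :=
    (hB.of_le (le_self_add.trans hmn)).comp p contDiffAt_fst
  have hfibre : ContDiffAt ℝ m (fun q : E × E => fderiv ℝ B q.1 q.2) p :=
    ((hB.fderiv_right hmn).comp p contDiffAt_fst).clm_apply contDiffAt_snd
  exact ((hcomp hfibre _ _).add (hcomp hbase _ _)).add (hcomp hbase _ _)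

theorem fderiv_bilinLift {B : E → V →L[ℝ] W →L[ℝ] X} {p : E × E} (hB : ContDiffAt ℝ 2 B p.1)
    (a : E × E) (b : V × V) (c : W × W) :
    fderiv ℝ (bilinLift B) p a b c = trilinLift (fderiv ℝ B) p a b c := by
  have hlift : DifferentiableAt ℝ (bilinLift B) p :=
    (contDiffAt_bilinLift (m := 1) hB (by norm_num)).differentiableAt (by simp)
  have hbase : HasFDerivAt (fun q : E × E => B q.1) (fderiv ℝ B p.1 ∘L .fst ℝ E E) p :=
    (hB.differentiableAt (by simp)).hasFDerivAt.comp p hasFDerivAt_fst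
  have hbase_apply (v : V) (w : W) :=
    (hbase.clm_apply (hasFDerivAt_const v p)).clm_apply (hasFDerivAt_const w p)
  have hfibre_apply (v : V) (w : W) :=
    ((hasFDerivAt_fderiv_apply (differentiableAt_fderiv hB)).clm_apply
      (hasFDerivAt_const v p)).clm_apply (hasFDerivAt_const w p)
  rw [← fderiv_clm_apply_const₂ hlift]
  simp only [bilinLift_apply]
  rw [(((hfibre_apply b.1 c.1).fun_add (hbase_apply b.2 c.1)).fun_add
    (hbase_apply b.1 c.2)).fderiv, trilinLift, fderiv_fderiv_comm hB p.2 a.1]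
  simp only [ContinuousLinearMap.comp_zero, ContinuousLinearMap.flip_add, add_apply, zero_add,
    ContinuousLinearMap.flip_apply, ContinuousLinearMap.comp_apply, ContinuousLinearMap.coe_snd',
    ContinuousLinearMap.coe_fst']
  abel

theorem isInvertible_bilinLift [CompleteSpace E] {G : E → E →L[ℝ] E →L[ℝ] ℝ} {p : E × E}
    (hG : (G p.1).IsInvertible) : (bilinLift G p).IsInvertible := by
  have hker : (bilinLift G p).ker = ⊥ := by
    refine LinearMap.ker_eq_bot'.2 fun a ha => ?_
    have hval (b : E × E) : bilinLift G p a b = 0 := DFunLike.congr_fun ha b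
    have hfst : a.1 = 0 := hG.injective (ContinuousLinearMap.ext fun w => by
      simpa [bilinLift_apply] using hval (0, w))
    have hsnd : a.2 = 0 := hG.injective (ContinuousLinearMap.ext fun w => by
      simpa [bilinLift_apply, hfst] using hval (w, 0))
    exact Prod.ext hfst hsnd
  have hrange : (bilinLift G p).range = ⊤ := by
    refine LinearMap.range_eq_top.2 fun f => ?_
    obtain ⟨a, ha⟩ := hG.surjective (f ∘L .inr ℝ E E)
    obtain ⟨a', ha'⟩ := hG.surjective (f ∘L .inl ℝ E E - fderiv ℝ G p.1 p.2 a)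
    refine ⟨(a, a'), ContinuousLinearMap.ext fun b => ?_⟩
    have hb : f b = f (b.1, 0) + f (0, b.2) := by rw [← map_add]; simp
    change bilinLift G p (a, a') b = f b
    rw [bilinLift_apply, ha, ha', hb]
    simp
  exact ⟨.ofBijective _ hker hrange, ContinuousLinearEquiv.coe_ofBijective _ _ _⟩

theorem fderiv_pullForm_fderiv {G : F → F →L[ℝ] F →L[ℝ] ℝ} {φ : E → F} {y : E}
    (hφ : ContDiffAt ℝ 2 φ y) (hG : DifferentiableAt ℝ G (φ y)) (v a b : E) :
    fderiv ℝ (fun z => pullForm (G (φ z)) (fderiv ℝ φ z) (fderiv ℝ φ z)) y v a b =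
      fderiv ℝ G (φ y) (fderiv ℝ φ y v) (fderiv ℝ φ y a) (fderiv ℝ φ y b)
        + G (φ y) (fderiv ℝ (fderiv ℝ φ) y v a) (fderiv ℝ φ y b)
        + G (φ y) (fderiv ℝ φ y a) (fderiv ℝ (fderiv ℝ φ) y v b) := by
  have hφ' := differentiableAt_fderiv hφ
  have hcomp : HasFDerivAt (fun z => G (φ z)) (fderiv ℝ G (φ y) ∘L fderiv ℝ φ y) y :=
    hG.hasFDerivAt.comp y (hφ.differentiableAt (by simp)).hasFDerivAt
  have hpull : DifferentiableAt ℝ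
      (fun z => pullForm (G (φ z)) (fderiv ℝ φ z) (fderiv ℝ φ z)) y :=
    (((ContinuousLinearMap.compL ℝ E F ℝ).flip.differentiableAt.comp y hφ').clm_comp
      (hcomp.differentiableAt.clm_comp hφ'))
  have hpush (c : E) := hφ'.hasFDerivAt.clm_apply (hasFDerivAt_const c y)
  rw [← fderiv_clm_apply_const₂ hpull]
  simp only [pullForm_apply]
  rw [((hcomp.clm_apply (hpush a)).clm_apply (hpush b)).fderiv]
  simp only [ContinuousLinearMap.comp_zero, zero_add, ContinuousLinearMap.flip_add, add_apply,
    ContinuousLinearMap.comp_apply, ContinuousLinearMap.flip_apply]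
  ring

theorem bilinLift_pullForm {G : F → F →L[ℝ] F →L[ℝ] ℝ} {φ : E → F} {p : E × E}
    (hφ : ContDiffAt ℝ 2 φ p.1) (hG : DifferentiableAt ℝ G (φ p.1)) :
    bilinLift (fun y => pullForm (G (φ y)) (fderiv ℝ φ y) (fderiv ℝ φ y)) p =
      pullForm (bilinLift G (tangentFun φ p)) (fderiv ℝ (tangentFun φ) p)
        (fderiv ℝ (tangentFun φ) p) := by
  refine ContinuousLinearMap.ext fun a => ContinuousLinearMap.ext fun b => ?_
  simp only [pullForm_apply, bilinLift_apply, fderiv_tangentFun hφ, fderiv_pullForm_fderiv hφ hG,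
    tangentFun, map_add, add_apply]
  ring

end TangentLift

section LeviCivita

variable {E : Type*} [NormedAddCommGroup E] [NormedSpace ℝ E]
  {G : E → E →L[ℝ] E →L[ℝ] ℝ} {U : Set E} {y : E}

theorem christoffel_congr {G' : E → E →L[ℝ] E →L[ℝ] ℝ} (h : G =ᶠ[nhds y] G') :
    christoffel G y = christoffel G' y := by
  rw [christoffel, christoffel, christoffelFirst, christoffelFirst, h.fderiv_eq, h.eq_of_nhds]

theorem riemann_congr {G' : E → E →L[ℝ] E →L[ℝ] ℝ} (h : G =ᶠ[nhds y] G') (a b c : E) :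
    riemann G y a b c = riemann G' y a b c := by
  have hchristoffel (b c : E) :
      (fun z => christoffel G z b c) =ᶠ[nhds y] fun z => christoffel G' z b c := by
    filter_upwards [h.eventuallyEq_nhds] with z hz
    rw [christoffel_congr hz]
  rw [riemann, riemann, (hchristoffel b c).fderiv_eq, (hchristoffel a c).fderiv_eq,
    christoffel_congr h]

theorem riemann_swap (G : E → E →L[ℝ] E →L[ℝ] ℝ) (y a b c : E) :
    riemann G y a b c = -riemann G y b a c := by
  rw [riemann, riemann]
  abel

theorem riemann_self (G : E → E →L[ℝ] E →L[ℝ] ℝ) (y a c : E) : riemann G y a a c = 0 := by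
  rw [riemann]
  abel

theorem nablaRiemann_self (G : E → E →L[ℝ] E →L[ℝ] ℝ) (y u a c : E) :
    nablaRiemann G y u a a c = 0 := by
  simp [nablaRiemann, riemann_self, riemann_swap G y a (christoffel G y u a)]

/-- The second covariant derivative `∇_a ∇_b c` of constant fields `a`, `b`, `c`, with respect to
the Levi-Civita connection of `G` in coordinates. -/
def secondCovDeriv (G : E → E →L[ℝ] E →L[ℝ] ℝ) (y : E) : E →L[ℝ] E →L[ℝ] E →L[ℝ] E :=
  fderiv ℝ (christoffel G) y +
    (ContinuousLinearMap.compL ℝ E E E).bilinearComp (christoffel G y) (christoffel G y)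

theorem secondCovDeriv_apply (G : E → E →L[ℝ] E →L[ℝ] ℝ) (y a b c : E) :
    secondCovDeriv G y a b c =
      fderiv ℝ (christoffel G) y a b c + christoffel G y a (christoffel G y b c) := rfl

/-- The curvature `riemann G y`, bundled as a continuous trilinear map. -/
def riemannTensor (G : E → E →L[ℝ] E →L[ℝ] ℝ) (y : E) : E →L[ℝ] E →L[ℝ] E →L[ℝ] E :=
  secondCovDeriv G y - (secondCovDeriv G y).flip

theorem riemannTensor_apply (G : E → E →L[ℝ] E →L[ℝ] ℝ) (y a b c : E) :
    riemannTensor G y a b c = secondCovDeriv G y a b c - secondCovDeriv G y b a c := rfl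

theorem riemann_eq_riemannTensor (hΓ : DifferentiableAt ℝ (christoffel G) y) (a b c : E) :
    riemann G y a b c = riemannTensor G y a b c := by
  rw [riemann, fderiv_clm_apply_const₂ hΓ, fderiv_clm_apply_const₂ hΓ, riemannTensor_apply,
    secondCovDeriv_apply, secondCovDeriv_apply]
  abel

theorem contDiffAt_christoffelFirst {m n : ℕ∞ω} (hG : ContDiffAt ℝ n G y) (hmn : m + 1 ≤ n) :
    ContDiffAt ℝ m (christoffelFirst G) y := by
  have hD : ContDiffAt ℝ m (fderiv ℝ G) y := hG.fderiv_right hmn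
  have hcycle : ContDiffAt ℝ m (fun z => cycle (fderiv ℝ G z)) y :=
    contDiffAt_const.clm_comp (contDiffAt_clm_flip hD)
  exact ((hD.add (contDiffAt_clm_flip hD)).sub hcycle).const_smul (1 / 2 : ℝ)

theorem fderiv_christoffelFirst (hG : ContDiffAt ℝ 2 G y) (v a b c : E) :
    fderiv ℝ (christoffelFirst G) y v a b c =
      (1 / 2) * (fderiv ℝ (fderiv ℝ G) y v a b c + fderiv ℝ (fderiv ℝ G) y v b a c
        - fderiv ℝ (fderiv ℝ G) y v c a b) := by
  have happly (a b c : E) :=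
    (((differentiableAt_fderiv hG).hasFDerivAt.clm_apply (hasFDerivAt_const a y)).clm_apply
      (hasFDerivAt_const b y)).clm_apply (hasFDerivAt_const c y)
  rw [← fderiv_clm_apply_const₃
    ((contDiffAt_christoffelFirst (m := 1) hG (by norm_num)).differentiableAt (by simp))]
  simp only [christoffelFirst_apply]
  rw [((((happly a b c).fun_add (happly b a c)).fun_sub (happly c a b)).const_mul (1 / 2)).fderiv]
  simp

theorem christoffelFirst_bilinLift {p : E × E} (hG : ContDiffAt ℝ 2 G p.1) (a b c : E × E) :
    christoffelFirst (bilinLift G) p a b c = trilinLift (christoffelFirst G) p a b c := by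
  simp only [christoffelFirst_apply, fderiv_bilinLift hG, trilinLift, fderiv_christoffelFirst hG]
  ring

/-- A smooth field of nondegenerate symmetric forms on an open set. Nondegeneracy is meant in the
strong sense, so that the Christoffel symbols exist also on a Banach space. -/
structure IsMetricOn (G : E → E →L[ℝ] E →L[ℝ] ℝ) (U : Set E) : Prop where
  isOpen : IsOpen U
  contDiffOn : ContDiffOn ℝ ∞ G U
  symm : ∀ y ∈ U, ∀ v w, G y v w = G y w v
  invertible : ∀ y ∈ U, (G y).IsInvertible

namespace IsMetricOn

theorem congr {G' : E → E →L[ℝ] E →L[ℝ] ℝ} (hG : IsMetricOn G U) (h : Set.EqOn G' G U) :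
    IsMetricOn G' U where
  isOpen := hG.isOpen
  contDiffOn := hG.contDiffOn.congr h
  symm y hy v w := by rw [h hy, hG.symm y hy]
  invertible y hy := by rw [h hy]; exact hG.invertible y hy

theorem contDiffAt (hG : IsMetricOn G U) (hy : y ∈ U) : ContDiffAt ℝ ∞ G y :=
  hG.contDiffOn.contDiffAt (hG.isOpen.mem_nhds hy)

theorem differentiableAt (hG : IsMetricOn G U) (hy : y ∈ U) : DifferentiableAt ℝ G y :=
  (hG.contDiffAt hy).differentiableAt (by simp)

theorem contDiffAt_two (hG : IsMetricOn G U) (hy : y ∈ U) : ContDiffAt ℝ 2 G y :=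
  (hG.contDiffAt hy).of_le ENat.LEInfty.out

theorem fderiv_symm (hG : IsMetricOn G U) (hy : y ∈ U) (a v w : E) :
    fderiv ℝ G y a v w = fderiv ℝ G y a w v := by
  have hgerm : (fun z => G z v w) =ᶠ[nhds y] fun z => G z w v :=
    Filter.eventually_of_mem (hG.isOpen.mem_nhds hy) fun z hz => hG.symm z hz v w
  rw [← fderiv_clm_apply_const₂ (hG.differentiableAt hy), hgerm.fderiv_eq,
    fderiv_clm_apply_const₂ (hG.differentiableAt hy)]

theorem apply_christoffel (hG : IsMetricOn G U) (hy : y ∈ U) (v w : E) :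
    G y (christoffel G y v w) = christoffelFirst G y v w :=
  (hG.invertible y hy).self_apply_inverse _

theorem eq_christoffel (hG : IsMetricOn G U) (hy : y ∈ U) {v w t : E}
    (h : ∀ z, G y t z = christoffelFirst G y v w z) : christoffel G y v w = t :=
  (hG.invertible y hy).injective <| by
    rw [hG.apply_christoffel hy]
    exact (ContinuousLinearMap.ext h).symm

theorem fderiv_eq_christoffel (hG : IsMetricOn G U) (hy : y ∈ U) (u v w : E) :
    fderiv ℝ G y u v w = G y v (christoffel G y u w) + G y (christoffel G y u v) w := by
  rw [hG.symm y hy v, hG.apply_christoffel hy, hG.apply_christoffel hy, christoffelFirst_apply,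
    christoffelFirst_apply, hG.fderiv_symm hy u w v, hG.fderiv_symm hy w u v,
    hG.fderiv_symm hy v u w]
  ring

variable [CompleteSpace E]

theorem contDiffAt_christoffel (hG : IsMetricOn G U) (hy : y ∈ U) :
    ContDiffAt ℝ ∞ (christoffel G) y := by
  have hinverse : ContDiffAt ℝ ∞ (fun z => (G z).inverse) y :=
    (hG.invertible y hy).contDiffAt_map_inverse.comp y (hG.contDiffAt hy)
  have hraise : ContDiffAt ℝ ∞
      (fun z => ContinuousLinearMap.compL ℝ E (E →L[ℝ] ℝ) E (G z).inverse) y :=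
    contDiffAt_const.clm_apply hinverse
  exact hraise.clm_comp (contDiffAt_christoffelFirst (hG.contDiffAt hy) (by simp))

theorem contDiffAt_two_christoffel (hG : IsMetricOn G U) (hy : y ∈ U) :
    ContDiffAt ℝ 2 (christoffel G) y :=
  (hG.contDiffAt_christoffel hy).of_le ENat.LEInfty.out

theorem differentiableAt_christoffel (hG : IsMetricOn G U) (hy : y ∈ U) :
    DifferentiableAt ℝ (christoffel G) y :=
  (hG.contDiffAt_christoffel hy).differentiableAt (by simp)

theorem bilinLift (hG : IsMetricOn G U) :
    IsMetricOn (bilinLift G) (U ×ˢ (Set.univ : Set E)) where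
  isOpen := hG.isOpen.prod isOpen_univ
  contDiffOn p hp :=
    (contDiffAt_bilinLift (m := ∞) (hG.contDiffAt hp.1) (by simp)).contDiffWithinAt
  symm p hp a b := by
    rw [bilinLift_apply, bilinLift_apply, hG.fderiv_symm hp.1, hG.symm _ hp.1 a.2,
      hG.symm _ hp.1 a.1]
    ring
  invertible p hp := isInvertible_bilinLift (hG.invertible p.1 hp.1)

theorem fderiv_christoffelFirst_eq_christoffel (hG : IsMetricOn G U) (hy : y ∈ U) (v a b c : E) :
    fderiv ℝ (christoffelFirst G) y v a b c =
      fderiv ℝ G y v (christoffel G y a b) c + G y (fderiv ℝ (christoffel G) y v a b) c := by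
  have hgerm : (fun z => christoffelFirst G z a b c) =ᶠ[nhds y]
      fun z => G z (christoffel G z a b) c :=
    Filter.eventually_of_mem (hG.isOpen.mem_nhds hy) fun z hz => by
      simp only [hG.apply_christoffel hz]
  have hΓ := ((hG.differentiableAt_christoffel hy).hasFDerivAt.clm_apply
    (hasFDerivAt_const a y)).clm_apply (hasFDerivAt_const b y)
  rw [← fderiv_clm_apply_const₃ ((contDiffAt_christoffelFirst (m := 1) (hG.contDiffAt_two hy)
      (by norm_num)).differentiableAt (by simp)), hgerm.fderiv_eq,
    (((hG.differentiableAt hy).hasFDerivAt.clm_apply hΓ).clm_apply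
      (hasFDerivAt_const c y)).fderiv]
  simp [add_comm]

theorem christoffel_bilinLift (hG : IsMetricOn G U) {p : E × E} (hp : p.1 ∈ U) (a b : E × E) :
    christoffel (Norden.bilinLift G) p a b =
      (christoffel G p.1 a.1 b.1, Norden.bilinLift (christoffel G) p a b) := by
  refine hG.bilinLift.eq_christoffel ⟨hp, trivial⟩ fun c => ?_
  rw [christoffelFirst_bilinLift (hG.contDiffAt_two hp), trilinLift,
    hG.fderiv_christoffelFirst_eq_christoffel hp, bilinLift_apply, bilinLift_apply]
  simp only [← hG.apply_christoffel hp, map_add, add_apply]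
  ring

theorem fderiv_christoffel_bilinLift (hG : IsMetricOn G U) {p : E × E} (hp : p.1 ∈ U)
    (a b c : E × E) :
    fderiv ℝ (christoffel (Norden.bilinLift G)) p a b c =
      (fderiv ℝ (christoffel G) p.1 a.1 b.1 c.1,
        trilinLift (fderiv ℝ (christoffel G)) p a b c) := by
  have hp' : p ∈ U ×ˢ (Set.univ : Set E) := ⟨hp, trivial⟩
  have hgerm : (fun q => christoffel (Norden.bilinLift G) q b c) =ᶠ[nhds p]
      fun q => (christoffel G q.1 b.1 c.1, Norden.bilinLift (christoffel G) q b c) :=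
    Filter.eventually_of_mem ((hG.isOpen.prod isOpen_univ).mem_nhds hp') fun q hq =>
      hG.christoffel_bilinLift hq.1 b c
  have hbase : HasFDerivAt (fun q : E × E => christoffel G q.1) _ p :=
    (hG.differentiableAt_christoffel hp).hasFDerivAt.comp p hasFDerivAt_fst
  have hfibre : DifferentiableAt ℝ (Norden.bilinLift (christoffel G)) p :=
    (contDiffAt_bilinLift (m := 1) (hG.contDiffAt_two_christoffel hp)
      (by norm_num)).differentiableAt (by simp)
  have hderiv := ((hbase.clm_apply (hasFDerivAt_const b.1 p)).clm_apply
    (hasFDerivAt_const c.1 p)).prodMk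
    ((hfibre.hasFDerivAt.clm_apply (hasFDerivAt_const b p)).clm_apply (hasFDerivAt_const c p))
  rw [← fderiv_clm_apply_const₂ (hG.bilinLift.differentiableAt_christoffel hp'), hgerm.fderiv_eq,
    hderiv.fderiv, ← fderiv_bilinLift (hG.contDiffAt_two_christoffel hp)]
  simp

theorem differentiableAt_secondCovDeriv (hG : IsMetricOn G U) (hy : y ∈ U) :
    DifferentiableAt ℝ (secondCovDeriv G) y := by
  have hcomp : DifferentiableAt ℝ (fun z => (ContinuousLinearMap.compL ℝ E E E).bilinearComp
      (christoffel G z) (christoffel G z)) y := by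
    have hleft : ContDiffAt ℝ 1 (fun z => ContinuousLinearMap.compL ℝ E E E ∘L christoffel G z) y :=
      contDiffAt_const.clm_comp ((hG.contDiffAt_christoffel hy).of_le ENat.LEInfty.out)
    exact (contDiffAt_clm_flip ((contDiffAt_clm_flip hleft).clm_comp
      ((hG.contDiffAt_christoffel hy).of_le ENat.LEInfty.out))).differentiableAt (by simp)
  exact (differentiableAt_fderiv (hG.contDiffAt_two_christoffel hy)).add hcomp

theorem fderiv_secondCovDeriv (hG : IsMetricOn G U) (hy : y ∈ U) (v a b c : E) :
    fderiv ℝ (secondCovDeriv G) y v a b c =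
      fderiv ℝ (fderiv ℝ (christoffel G)) y v a b c
        + (fderiv ℝ (christoffel G) y v a (christoffel G y b c)
          + christoffel G y a (fderiv ℝ (christoffel G) y v b c)) := by
  have hΓ := (hG.differentiableAt_christoffel hy).hasFDerivAt
  have hΓ' := (differentiableAt_fderiv (hG.contDiffAt_two_christoffel hy)).hasFDerivAt
  rw [← fderiv_clm_apply_const₃ (hG.differentiableAt_secondCovDeriv hy)]
  simp only [secondCovDeriv_apply]
  rw [((((hΓ'.clm_apply (hasFDerivAt_const a y)).clm_apply (hasFDerivAt_const b y)).clm_apply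
    (hasFDerivAt_const c y)).fun_add ((hΓ.clm_apply (hasFDerivAt_const a y)).clm_apply
    ((hΓ.clm_apply (hasFDerivAt_const b y)).clm_apply (hasFDerivAt_const c y)))).fderiv]
  simp [add_comm]

theorem secondCovDeriv_bilinLift (hG : IsMetricOn G U) {p : E × E} (hp : p.1 ∈ U)
    (a b c : E × E) :
    secondCovDeriv (Norden.bilinLift G) p a b c =
      (secondCovDeriv G p.1 a.1 b.1 c.1, trilinLift (secondCovDeriv G) p a b c) := by
  rw [secondCovDeriv_apply, hG.fderiv_christoffel_bilinLift hp]
  simp only [hG.christoffel_bilinLift hp, bilinLift_apply, trilinLift, secondCovDeriv_apply,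
    hG.fderiv_secondCovDeriv hp, map_add, Prod.mk_add_mk, Prod.mk.injEq, true_and]
  abel

theorem riemann_eq (hG : IsMetricOn G U) (hy : y ∈ U) (a b c : E) :
    riemann G y a b c = riemannTensor G y a b c :=
  riemann_eq_riemannTensor (hG.differentiableAt_christoffel hy) a b c

theorem riemann_bilinLift (hG : IsMetricOn G U) {p : E × E} (hp : p.1 ∈ U) (a b c : E × E) :
    riemann (Norden.bilinLift G) p a b c =
      (riemann G p.1 a.1 b.1 c.1, trilinLift (riemannTensor G) p a b c) := by
  have hlift : trilinLift (riemannTensor G) p a b c =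
      trilinLift (secondCovDeriv G) p a b c - trilinLift (secondCovDeriv G) p b a c :=
    trilinLift_sub_flip (hG.differentiableAt_secondCovDeriv hp) a b c
  rw [hG.bilinLift.riemann_eq ⟨hp, trivial⟩, hG.riemann_eq hp, riemannTensor_apply,
    hG.secondCovDeriv_bilinLift hp, hG.secondCovDeriv_bilinLift hp, hlift, Prod.mk_sub_mk,
    riemannTensor_apply]

theorem fderiv_riemannTensor (hG : IsMetricOn G U) (hy : y ∈ U) (v a b c : E) :
    fderiv ℝ (riemannTensor G) y v a b c =
      nablaRiemann G y v a b c - christoffel G y v (riemannTensor G y a b c)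
        + riemannTensor G y (christoffel G y v a) b c
        + riemannTensor G y a (christoffel G y v b) c
        + riemannTensor G y a b (christoffel G y v c) := by
  have hgerm : (fun z => riemann G z a b c) =ᶠ[nhds y] fun z => riemannTensor G z a b c :=
    Filter.eventually_of_mem (hG.isOpen.mem_nhds hy) fun z hz => hG.riemann_eq hz a b c
  have hD := hG.differentiableAt_secondCovDeriv hy
  have hflip : DifferentiableAt ℝ (fun z => (secondCovDeriv G z).flip) y :=
    (ContinuousLinearMap.flipₗᵢ ℝ E E (E →L[ℝ] E)).toContinuousLinearEquiv.differentiableAt.comp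
      y hD
  rw [nablaRiemann, hgerm.fderiv_eq, fderiv_clm_apply_const₃ (T := riemannTensor G) (hD.sub hflip)]
  simp only [hG.riemann_eq hy]
  abel

theorem snd_riemann_bilinLift_add_christoffel (hG : IsMetricOn G U) {p : E × E} (hp : p.1 ∈ U)
    (a b c : E × E) :
    (riemann (Norden.bilinLift G) p a b c).2
        + christoffel G p.1 p.2 (riemann (Norden.bilinLift G) p a b c).1 =
      nablaRiemann G p.1 p.2 a.1 b.1 c.1
        + riemann G p.1 (a.2 + christoffel G p.1 p.2 a.1) b.1 c.1
        + riemann G p.1 a.1 (b.2 + christoffel G p.1 p.2 b.1) c.1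
        + riemann G p.1 a.1 b.1 (c.2 + christoffel G p.1 p.2 c.1) := by
  rw [hG.riemann_bilinLift hp, trilinLift, hG.fderiv_riemannTensor hp]
  simp only [hG.riemann_eq hp, map_add, add_apply]
  abel

end IsMetricOn

end LeviCivita

section Charts

variable {E : Type*} [NormedAddCommGroup E] [NormedSpace ℝ E]
  {H : Type*} [TopologicalSpace H] {I : ModelWithCorners ℝ E H}
  {M : Type*} [TopologicalSpace M] [ChartedSpace H M]

theorem isInvertible_of_nondegenerate {V : Type*} [NormedAddCommGroup V] [NormedSpace ℝ V]
    [FiniteDimensional ℝ V] {B : V →L[ℝ] V →L[ℝ] ℝ} (hB : ∀ v, (∀ w, B v w = 0) → v = 0) :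
    B.IsInvertible := by
  have hinj : Function.Injective (B : V →ₗ[ℝ] V →L[ℝ] ℝ) :=
    (injective_iff_map_eq_zero _).2 fun v hv => hB v fun w => DFunLike.congr_fun hv w
  have hdim : Module.finrank ℝ V = Module.finrank ℝ (V →L[ℝ] ℝ) :=
    Subspace.dual_finrank_eq.symm.trans LinearMap.toContinuousLinearMap.finrank_eq
  exact ⟨(LinearEquiv.ofInjectiveOfFinrankEq _ hinj hdim).toContinuousLinearEquiv, rfl⟩

theorem isOpen_coordChange_source [I.Boundaryless] (x x' : M) :
    IsOpen ((extChartAt I x).symm ≫ extChartAt I x').source := by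
  rw [PartialEquiv.trans_source, PartialEquiv.symm_source]
  exact (continuousOn_extChartAt_symm x).isOpen_inter_preimage
    (isOpen_extChartAt_target x) (isOpen_extChartAt_source x')

section

variable [IsManifold I 1 M]

theorem inChart_apply_of_mem (g : FormField I M) {x p : M} (hp : p ∈ (extChartAt I x).source)
    (v w : E) :
    inChart g x (extChartAt I x p) v w =
      g p (tangentCoordChange I x p p v) (tangentCoordChange I x p p w) := by
  rw [inChart, pullForm_apply, (extChartAt I x).left_inv hp,
    TangentBundle.symmL_trivializationAt_eq_core (by rwa [extChartAt_source] at hp)]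
  rfl

theorem inChart_self (g : FormField I M) (x : M) (v w : E) :
    inChart g x (extChartAt I x x) v w = g x v w := by
  have hx := mem_extChartAt_source (I := I) x
  rw [inChart_apply_of_mem g hx, tangentCoordChange_self hx, tangentCoordChange_self hx]

theorem fderiv_coordChange [I.Boundaryless] {x x' p : M} :
    fderiv ℝ (extChartAt I x' ∘ (extChartAt I x).symm) (extChartAt I x p) =
      tangentCoordChange I x x' p := by
  rw [tangentCoordChange_def, I.range_eq_univ, fderivWithin_univ]

theorem inChart_eq_pullForm [I.Boundaryless] (g : FormField I M) {x x' : M} {y : E}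
    (hy : y ∈ ((extChartAt I x).symm ≫ extChartAt I x').source) :
    inChart g x y = pullForm
      (inChart g x' ((extChartAt I x' ∘ (extChartAt I x).symm) y))
      (fderiv ℝ (extChartAt I x' ∘ (extChartAt I x).symm) y)
      (fderiv ℝ (extChartAt I x' ∘ (extChartAt I x).symm) y) := by
  obtain ⟨p, ⟨hp, hp'⟩, rfl⟩ : ∃ p, (p ∈ (extChartAt I x).source ∧ p ∈ (extChartAt I x').source) ∧
      extChartAt I x p = y :=
    ⟨(extChartAt I x).symm y, ⟨(extChartAt I x).map_target hy.1, hy.2⟩,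
      (extChartAt I x).right_inv hy.1⟩
  refine ContinuousLinearMap.ext fun v => ContinuousLinearMap.ext fun w => ?_
  rw [inChart_apply_of_mem g hp, pullForm_apply, fderiv_coordChange, Function.comp_apply,
    (extChartAt I x).left_inv hp, inChart_apply_of_mem g hp',
    tangentCoordChange_comp ⟨⟨hp, hp'⟩, mem_extChartAt_source p⟩,
    tangentCoordChange_comp ⟨⟨hp, hp'⟩, mem_extChartAt_source p⟩]

end

variable [IsManifold I ∞ M]

theorem contDiffAt_coordChange [I.Boundaryless] {x x' : M} {y : E}
    (hy : y ∈ ((extChartAt I x).symm ≫ extChartAt I x').source) :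
    ContDiffAt ℝ ∞ (extChartAt I x' ∘ (extChartAt I x).symm) y := by
  have hwithin := contDiffWithinAt_ext_coord_change (n := ∞) x' x hy
  rwa [I.range_eq_univ, contDiffWithinAt_univ] at hwithin

theorem contMDiffOn_symmL_trivializationAt (x : M) (v : E) :
    ContMDiffOn I (I.prod 𝓘(ℝ, E)) ∞
      (fun p : M => TotalSpace.mk' E (E := (TangentSpace I : M → Type _)) p
        ((trivializationAt E (TangentSpace I : M → Type _) x).symmL ℝ p v))
      (chartAt H x).source := by
  let e := trivializationAt E (TangentSpace I : M → Type _) x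
  have hconst : ContMDiffOn I (I.prod 𝓘(ℝ, E)) ∞ (fun p : M => (p, v)) e.baseSet :=
    (contMDiff_id.prodMk contMDiff_const).contMDiffOn
  refine ((e.contMDiffOn_symm (n := ∞)).comp hconst fun p hp => ?_).congr fun p hp => ?_
  · rw [e.target_eq]
    exact ⟨hp, trivial⟩
  · rw [e.symmL_apply hp]
    exact e.mk_symm hp v

namespace IsPseudoRiemannianMetric

variable {g : FormField I M}

theorem contDiffOn_inChart [FiniteDimensional ℝ E] (hg : IsPseudoRiemannianMetric I M g) (x : M) :
    ContDiffOn ℝ ∞ (inChart g x) (extChartAt I x).target := by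
  let e := trivializationAt E (TangentSpace I : M → Type _) x
  refine contDiffOn_clm_apply.2 fun v => contDiffOn_clm_apply.2 fun w => ?_
  have hvalue : ContMDiffOn I 𝓘(ℝ, ℝ) ∞ (fun p : M => g p (e.symmL ℝ p v) (e.symmL ℝ p w))
      (chartAt H x).source := by
    have hsection : ContMDiffOn I (I.prod 𝓘(ℝ, ℝ)) ∞ (fun p : M => TotalSpace.mk' ℝ
        (E := Bundle.Trivial M ℝ) p (g p (e.symmL ℝ p v) (e.symmL ℝ p w))) (chartAt H x).source :=
      ContMDiffOn.clm_bundle_apply₂ (F₁ := E) (F₂ := E) (b := fun p => p)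
        hg.contMDiff.contMDiffOn (contMDiffOn_symmL_trivializationAt x v)
        (contMDiffOn_symmL_trivializationAt x w)
    exact fun p hp => (contMDiffWithinAt_totalSpace.1 (hsection p hp)).2
  rw [← contMDiffOn_iff_contDiffOn]
  exact hvalue.comp (contMDiffOn_extChartAt_symm x) fun y hy =>
    extChartAt_source I x ▸ (extChartAt I x).map_target hy

theorem nondegenerate_inChart (hg : IsPseudoRiemannianMetric I M g) (x : M) {y : E}
    (hy : y ∈ (extChartAt I x).target) (v : E) (hv : ∀ w, inChart g x y v w = 0) : v = 0 := by
  let e := trivializationAt E (TangentSpace I : M → Type _) x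
  have hp : (extChartAt I x).symm y ∈ e.baseSet := by
    have hsource := (extChartAt I x).map_target hy
    rwa [extChartAt_source] at hsource
  have hzero : e.symmL ℝ ((extChartAt I x).symm y) v = 0 := by
    refine hg.nondegenerate _ _ fun w => ?_
    rw [← e.symmL_continuousLinearMapAt (R := ℝ) hp w]
    exact hv _
  rw [← e.continuousLinearMapAt_symmL (R := ℝ) hp v, hzero, map_zero]

theorem isMetricOn [FiniteDimensional ℝ E] [I.Boundaryless]
    (hg : IsPseudoRiemannianMetric I M g) (x : M) :
    IsMetricOn (inChart g x) (extChartAt I x).target where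
  isOpen := isOpen_extChartAt_target x
  contDiffOn := hg.contDiffOn_inChart x
  symm _ _ _ _ := hg.symm _ _ _
  invertible _ hy := isInvertible_of_nondegenerate (hg.nondegenerate_inChart x hy)

end IsPseudoRiemannianMetric

end Charts

section CompleteLift

variable {E : Type*} [NormedAddCommGroup E] [NormedSpace ℝ E]
  {H : Type*} [TopologicalSpace H] {I : ModelWithCorners ℝ E H}
  {M : Type*} [TopologicalSpace M] [ChartedSpace H M]

section

variable [IsManifold I 1 M]

theorem extChartAt_tangentBundle (u w : TangentBundle I M) :
    extChartAt I.tangent u w =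
      (extChartAt I u.proj w.proj, tangentCoordChange I w.proj u.proj w.proj w.snd) := rfl

theorem extChartAt_tangentBundle_self (u : TangentBundle I M) :
    extChartAt I.tangent u u = (extChartAt I u.proj u.proj, u.snd) :=
  Prod.ext rfl (tangentCoordChange_self (mem_extChartAt_source u.proj) :
    tangentCoordChange I u.proj u.proj u.proj (u.snd : E) = u.snd)

theorem extChartAt_tangentBundle_symm (u : TangentBundle I M) (q : E × E) :
    (extChartAt I.tangent u).symm q = ⟨(extChartAt I u.proj).symm q.1,
      tangentCoordChange I u.proj ((extChartAt I u.proj).symm q.1)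
        ((extChartAt I u.proj).symm q.1) q.2⟩ := rfl

theorem extChartAt_tangentBundle_target (u : TangentBundle I M) :
    (extChartAt I.tangent u).target = (extChartAt I u.proj).target ×ˢ Set.univ := by
  refine (FiberBundle.extChartAt_target (IB := I) (E := (TangentSpace I : M → Type _)) u).trans
    (congrArg (· ×ˢ Set.univ) (Set.inter_eq_left.2 fun y hy => ?_))
  have hsource := (extChartAt I u.proj).map_target hy
  rwa [extChartAt_source] at hsource

theorem coordChange_tangentBundle_eventuallyEq [I.Boundaryless] (u w : TangentBundle I M)
    {q : E × E} (hq : q.1 ∈ ((extChartAt I u.proj).symm ≫ extChartAt I w.proj).source) :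
    extChartAt I.tangent w ∘ (extChartAt I.tangent u).symm =ᶠ[nhds q]
      tangentFun (extChartAt I w.proj ∘ (extChartAt I u.proj).symm) := by
  filter_upwards [((isOpen_coordChange_source _ _).preimage continuous_fst).mem_nhds hq] with r hr
  set p := (extChartAt I u.proj).symm r.1 with hp
  have hbase : r.1 = extChartAt I u.proj p := ((extChartAt I u.proj).right_inv hr.1).symm
  have hpu : p ∈ (extChartAt I u.proj).source := (extChartAt I u.proj).map_target hr.1
  rw [Function.comp_apply, extChartAt_tangentBundle_symm, extChartAt_tangentBundle, ← hp]
  refine Prod.ext rfl ?_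
  change tangentCoordChange I p w.proj p (tangentCoordChange I u.proj p p r.2) =
    fderiv ℝ (extChartAt I w.proj ∘ (extChartAt I u.proj).symm) r.1 r.2
  rw [hbase, fderiv_coordChange,
    tangentCoordChange_comp ⟨⟨hpu, mem_extChartAt_source p⟩, hr.2⟩]

end

variable [I.Boundaryless] [IsManifold I ∞ M] [FiniteDimensional ℝ E] {g : FormField I M}

namespace IsPseudoRiemannianMetric

theorem completeLift_eq_bilinLift (hg : IsPseudoRiemannianMetric I M g)
    (u : TangentBundle I M) (a b : E × E) :
    completeLift g u a b =
      bilinLift (inChart g u.proj) (extChartAt I u.proj u.proj, u.snd) a b := by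
  have hy := mem_extChartAt_target (I := I) u.proj
  set y := extChartAt I u.proj u.proj
  let v : E := u.snd
  have hinChart : completeLift g u a b =
      inChart g u.proj y a.1 (b.2 + christoffel (inChart g u.proj) y v b.1)
        + inChart g u.proj y (a.2 + christoffel (inChart g u.proj) y v a.1) b.1 := by
    rw [inChart_self, inChart_self]
    rfl
  refine hinChart.trans (Eq.trans ?_ (bilinLift_apply (inChart g u.proj) (y, v) a b).symm)
  rw [(hg.isMetricOn u.proj).fderiv_eq_christoffel hy, map_add, map_add, add_apply]
  ring

theorem bilinLift_inChart_eq_pullForm (hg : IsPseudoRiemannianMetric I M g) {x x' : M} {q : E × E}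
    (hq : q.1 ∈ ((extChartAt I x).symm ≫ extChartAt I x').source) :
    bilinLift (inChart g x) q = pullForm
      (bilinLift (inChart g x') (tangentFun (extChartAt I x' ∘ (extChartAt I x).symm) q))
      (fderiv ℝ (tangentFun (extChartAt I x' ∘ (extChartAt I x).symm)) q)
      (fderiv ℝ (tangentFun (extChartAt I x' ∘ (extChartAt I x).symm)) q) := by
  rw [bilinLift_congr (Filter.eventually_of_mem ((isOpen_coordChange_source x x').mem_nhds hq)
    fun y hy => inChart_eq_pullForm g hy)]
  exact bilinLift_pullForm ((contDiffAt_coordChange hq).of_le ENat.LEInfty.out)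
    ((hg.isMetricOn x').differentiableAt ((extChartAt I x').map_source hq.2))

theorem inChart_completeLift (hg : IsPseudoRiemannianMetric I M g) (u : TangentBundle I M)
    {q : E × E} (hq : q ∈ (extChartAt I.tangent u).target) :
    inChart (completeLift g) u q = bilinLift (inChart g u.proj) q := by
  set w := (extChartAt I.tangent u).symm q with hw
  have hwu : w ∈ (extChartAt I.tangent u).source := (extChartAt I.tangent u).map_target hq
  have hqw : extChartAt I.tangent u w = q := (extChartAt I.tangent u).right_inv hq
  have hbase : q.1 ∈ ((extChartAt I u.proj).symm ≫ extChartAt I w.proj).source := by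
    rw [extChartAt_tangentBundle_target] at hq
    exact ⟨hq.1, mem_extChartAt_source w.proj⟩
  have hchange := coordChange_tangentBundle_eventuallyEq u w hbase
  have hpoint : tangentFun (extChartAt I w.proj ∘ (extChartAt I u.proj).symm) q =
      (extChartAt I w.proj w.proj, w.snd) := by
    rw [← hchange.eq_of_nhds, Function.comp_apply, ← hw, extChartAt_tangentBundle_self]
  refine ContinuousLinearMap.ext fun a => ContinuousLinearMap.ext fun b => ?_
  rw [hg.bilinLift_inChart_eq_pullForm hbase, pullForm_apply, hpoint, ← hchange.fderiv_eq, ← hqw,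
    fderiv_coordChange]
  exact (inChart_apply_of_mem (completeLift g) hwu a b).trans
    (hg.completeLift_eq_bilinLift w _ _)

theorem isMetricOn_completeLift (hg : IsPseudoRiemannianMetric I M g) (u : TangentBundle I M) :
    IsMetricOn (E := E × E) (inChart (completeLift g) u) (extChartAt I.tangent u).target := by
  refine IsMetricOn.congr (E := E × E) (G := bilinLift (inChart g u.proj)) ?_
    fun q hq => hg.inChart_completeLift u hq
  rw [extChartAt_tangentBundle_target]
  exact (hg.isMetricOn u.proj).bilinLift

theorem curvature_completeLift (hg : IsPseudoRiemannianMetric I M g) (u : TangentBundle I M)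
    (A B C : TangentSpace I.tangent u) :
    curvature (completeLift g) u A B C =
      riemann (E := E × E) (bilinLift (inChart g u.proj))
        (extChartAt I u.proj u.proj, u.snd) A B C := by
  rw [curvature, extChartAt_tangentBundle_self]
  exact riemann_congr (E := E × E) (Filter.eventually_of_mem
    ((isOpen_extChartAt_target (I := I.tangent) u).mem_nhds
      (extChartAt_tangentBundle_self u ▸ mem_extChartAt_target (I := I.tangent) u))
    fun q hq => hg.inChart_completeLift u hq) A B C

theorem dproj_curvature_completeLift (hg : IsPseudoRiemannianMetric I M g)
    (u : TangentBundle I M) (A B C : TangentSpace I.tangent u) :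
    dproj u (curvature (completeLift g) u A B C) =
      curvature g u.proj (dproj u A) (dproj u B) (dproj u C) := by
  rw [hg.curvature_completeLift]
  exact congrArg Prod.fst ((hg.isMetricOn u.proj).riemann_bilinLift
    (p := (extChartAt I u.proj u.proj, u.snd)) (mem_extChartAt_target u.proj) A B C)

theorem connector_curvature_completeLift
    (hg : IsPseudoRiemannianMetric I M g)
    (u : TangentBundle I M) (A B C : TangentSpace I.tangent u) :
    connector g u (curvature (completeLift g) u A B C) =
      nablaCurvature g u.proj u.snd (dproj u A) (dproj u B) (dproj u C)
      + curvature g u.proj (connector g u A) (dproj u B) (dproj u C)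
      + curvature g u.proj (dproj u A) (connector g u B) (dproj u C)
      + curvature g u.proj (dproj u A) (dproj u B) (connector g u C) := by
  rw [hg.curvature_completeLift]
  exact (hg.isMetricOn u.proj).snd_riemann_bilinLift_add_christoffel
    (p := (extChartAt I u.proj u.proj, u.snd)) (mem_extChartAt_target u.proj) A B C

end IsPseudoRiemannianMetric

end CompleteLift

section SectionalCurvature

variable {E : Type*} [NormedAddCommGroup E] [NormedSpace ℝ E]
  {H : Type*} [TopologicalSpace H] {I : ModelWithCorners ℝ E H}
  {M : Type*} [TopologicalSpace M] [ChartedSpace H M]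
  {g : FormField I M} {x : M}

theorem gram_smul_smul (g : FormField I M) (x : M) (r s : ℝ) (a b : TangentSpace I x) :
    gram g x (r • a) (s • b) = (r * s) ^ 2 * gram g x a b := by
  simp only [gram, map_smul, smul_apply, smul_eq_mul]
  ring

namespace IsMetricOn

variable [IsManifold I 1 M] [CompleteSpace E] {U : Set E}

theorem curvature_smul (hg : IsMetricOn (inChart g x) U) (hx : extChartAt I x x ∈ U) (r s t : ℝ)
    (a b c : TangentSpace I x) :
    curvature g x (r • a) (s • b) (t • c) = (r * s * t) • curvature g x a b c := by
  have hriemann (r s t : ℝ) (a b c : E) :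
      riemann (inChart g x) (extChartAt I x x) (r • a) (s • b) (t • c) =
        (r * s * t) • riemann (inChart g x) (extChartAt I x x) a b c := by
    simp only [hg.riemann_eq hx, map_smul, smul_apply]
    module
  exact hriemann r s t a b c

theorem sectional_smul_smul (hg : IsMetricOn (inChart g x) U) (hx : extChartAt I x x ∈ U)
    {r s : ℝ} (hr : r ≠ 0) (hs : s ≠ 0) (a b : TangentSpace I x) :
    sectional g x (r • a) (s • b) = sectional g x a b := by
  rw [sectional, hg.curvature_smul hx, gram_smul_smul, sectional,
    ← mul_div_mul_left _ (gram g x a b) (pow_ne_zero 2 (mul_ne_zero hr hs))]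
  simp only [map_smul, smul_apply, smul_eq_mul]
  ring

end IsMetricOn

end SectionalCurvature

section SlopeLift

variable {E : Type*} [NormedAddCommGroup E] [NormedSpace ℝ E]
  {H : Type*} [TopologicalSpace H] {I : ModelWithCorners ℝ E H}
  {M : Type*} [TopologicalSpace M] [ChartedSpace H M]

section

variable [IsManifold I 1 M]

/-- The lift `X^H + ε X^V` of slope `ε`. Up to the factor `1 / √2`, the vectors `ξ` and `η` are the
lifts of slopes `1` and `-1`. -/
def slopeLift (g : FormField I M) (u : TangentBundle I M) (ε : ℝ) (X : TangentSpace I u.proj) :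
    TangentSpace I.tangent u :=
  hLift g u X + ε • vLift u X

variable (g : FormField I M) (u : TangentBundle I M) (ε δ : ℝ) (X Y : TangentSpace I u.proj)

theorem xi_eq_smul_slopeLift : xi g u X = (1 / √2 : ℝ) • slopeLift g u 1 X := by
  rw [xi, slopeLift, one_smul]

theorem eta_eq_smul_slopeLift : eta g u X = (1 / √2 : ℝ) • slopeLift g u (-1) X := by
  rw [eta, slopeLift, neg_one_smul, sub_eq_add_neg]

theorem dproj_slopeLift : dproj u (slopeLift g u ε X) = X := by
  rw [slopeLift, map_add, map_smul, dproj_hLift, dproj_vLift, smul_zero, add_zero]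

theorem connector_slopeLift : connector g u (slopeLift g u ε X) = ε • X := by
  rw [slopeLift, map_add, map_smul, connector_hLift, connector_vLift, zero_add]

theorem completeLift_slopeLift :
    completeLift g u (slopeLift g u ε X) (slopeLift g u δ Y) = (ε + δ) * g u.proj X Y := by
  rw [completeLift_apply, dproj_slopeLift, dproj_slopeLift, connector_slopeLift,
    connector_slopeLift, map_smul, map_smul, smul_apply, smul_eq_mul, smul_eq_mul]
  ring

theorem inv_sqrt_two_mul_self : (1 / √2 : ℝ) * (1 / √2) = 1 / 2 := by
  rw [div_mul_div_comm, one_mul, Real.mul_self_sqrt zero_le_two]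

theorem completeLift_xi_xi : completeLift g u (xi g u X) (xi g u Y) = g u.proj X Y := by
  simp only [xi_eq_smul_slopeLift, map_smul, smul_apply, smul_eq_mul, completeLift_slopeLift]
  linear_combination 2 * g u.proj X Y * inv_sqrt_two_mul_self

theorem completeLift_xi_eta : completeLift g u (xi g u X) (eta g u Y) = 0 := by
  simp [xi_eq_smul_slopeLift, eta_eq_smul_slopeLift, completeLift_slopeLift]

theorem completeLift_eta_xi : completeLift g u (eta g u X) (xi g u Y) = 0 := by
  simp [xi_eq_smul_slopeLift, eta_eq_smul_slopeLift, completeLift_slopeLift]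

theorem completeLift_eta_eta : completeLift g u (eta g u X) (eta g u Y) = -g u.proj X Y := by
  simp only [eta_eq_smul_slopeLift, map_smul, smul_apply, smul_eq_mul, completeLift_slopeLift]
  linear_combination -2 * g u.proj X Y * inv_sqrt_two_mul_self

theorem J₁_xi (J : EndField I M) : J₁ J g u (xi g u X) = -eta g u (J u.proj X) := by
  rw [xi, eta, map_smul, map_add, (J₁_lifts J g u X).1, (J₁_lifts J g u X).2]
  module

theorem J₁_eta (J : EndField I M) : J₁ J g u (eta g u X) = -xi g u (J u.proj X) := by
  rw [xi, eta, map_smul, map_sub, (J₁_lifts J g u X).1, (J₁_lifts J g u X).2]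
  module

theorem J₂_xi : J₂ g u (xi g u X) = -eta g u X := by
  rw [xi, eta, map_smul, map_add, (J₂_lifts g u X).1, (J₂_lifts g u X).2]
  module

theorem J₂_eta : J₂ g u (eta g u X) = xi g u X := by
  rw [xi, eta, map_smul, map_sub, (J₂_lifts g u X).1, (J₂_lifts g u X).2]
  module

theorem xi_neg : xi g u (-X) = -xi g u X := by
  simp only [xi, map_neg]
  module

theorem eta_neg : eta g u (-X) = -eta g u X := by
  simp only [eta, map_neg]
  module

end

namespace IsPseudoRiemannianMetric

variable [I.Boundaryless] [IsManifold I ∞ M] [FiniteDimensional ℝ E] {g : FormField I M}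
  {u : TangentBundle I M} {X Y : TangentSpace I u.proj}

theorem completeLift_curvature_slopeLift (hg : IsPseudoRiemannianMetric I M g) (ε δ : ℝ)
    (X Y : TangentSpace I u.proj) :
    completeLift g u (curvature (completeLift g) u (slopeLift g u ε X) (slopeLift g u δ Y)
        (slopeLift g u δ Y)) (slopeLift g u ε X) =
      g u.proj (nablaCurvature g u.proj u.snd X Y Y) X
        + 2 * (ε + δ) * g u.proj (curvature g u.proj X Y Y) X := by
  have hsmul (r s t : ℝ) := (hg.isMetricOn u.proj).curvature_smul
    (mem_extChartAt_target u.proj) r s t X Y Y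
  have hfirst : curvature g u.proj (ε • X) Y Y = ε • curvature g u.proj X Y Y := by
    simpa only [one_smul, mul_one] using hsmul ε 1 1
  have hsecond : curvature g u.proj X (δ • Y) Y = δ • curvature g u.proj X Y Y := by
    simpa only [one_smul, mul_one, one_mul] using hsmul 1 δ 1
  have hthird : curvature g u.proj X Y (δ • Y) = δ • curvature g u.proj X Y Y := by
    simpa only [one_smul, one_mul] using hsmul 1 1 δ
  rw [completeLift_apply, hg.dproj_curvature_completeLift, hg.connector_curvature_completeLift]
  simp only [dproj_slopeLift, connector_slopeLift, hfirst, hsecond, hthird, map_smul, map_add,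
    smul_apply, add_apply, smul_eq_mul]
  ring

theorem sectional_slopeLift (hg : IsPseudoRiemannianMetric I M g) (ε δ : ℝ)
    (hXY : g u.proj X Y = 0) :
    sectional (completeLift g) u (slopeLift g u ε X) (slopeLift g u δ Y) =
      (1 / 4 * nablaSectional g u.proj u.snd X Y + (ε + δ) / 2 * sectional g u.proj X Y)
        / (ε * δ) := by
  simp only [sectional, nablaSectional, gram, hg.completeLift_curvature_slopeLift,
    completeLift_slopeLift, hXY, mul_zero, zero_mul, sub_zero, div_eq_mul_inv, mul_inv,
    ← two_mul]
  ring

theorem sectional_slopeLift_self (hg : IsPseudoRiemannianMetric I M g) (ε δ : ℝ)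
    (X : TangentSpace I u.proj) :
    sectional (completeLift g) u (slopeLift g u ε X) (slopeLift g u δ X) = 0 := by
  have hcurvature : curvature g u.proj X X X = 0 := riemann_self (E := E) _ _ _ _
  have hnabla : nablaCurvature g u.proj u.snd X X X = 0 := nablaRiemann_self (E := E) _ _ _ _ _
  rw [sectional, hg.completeLift_curvature_slopeLift, hcurvature, hnabla, map_zero, zero_apply,
    mul_zero, add_zero, zero_div]

theorem sectional_completeLift_smul_smul (hg : IsPseudoRiemannianMetric I M g) {r s : ℝ}
    (hr : r ≠ 0) (hs : s ≠ 0) (A B : TangentSpace I.tangent u) :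
    sectional (completeLift g) u (r • A) (s • B) = sectional (completeLift g) u A B :=
  (hg.isMetricOn_completeLift u).sectional_smul_smul (E := E × E) (mem_extChartAt_target u)
    hr hs A B

theorem sectional_xi_xi (hg : IsPseudoRiemannianMetric I M g) (hXY : g u.proj X Y = 0) :
    sectional (completeLift g) u (xi g u X) (xi g u Y) =
      1 / 4 * nablaSectional g u.proj u.snd X Y + sectional g u.proj X Y := by
  rw [xi_eq_smul_slopeLift, xi_eq_smul_slopeLift,
    hg.sectional_completeLift_smul_smul (by simp) (by simp), hg.sectional_slopeLift _ _ hXY]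
  ring

theorem sectional_xi_eta (hg : IsPseudoRiemannianMetric I M g) (hXY : g u.proj X Y = 0) :
    sectional (completeLift g) u (xi g u X) (eta g u Y) =
      -(1 / 4) * nablaSectional g u.proj u.snd X Y := by
  rw [xi_eq_smul_slopeLift, eta_eq_smul_slopeLift,
    hg.sectional_completeLift_smul_smul (by simp) (by simp), hg.sectional_slopeLift _ _ hXY]
  ring

theorem sectional_eta_xi (hg : IsPseudoRiemannianMetric I M g) (hXY : g u.proj X Y = 0) :
    sectional (completeLift g) u (eta g u X) (xi g u Y) =
      -(1 / 4) * nablaSectional g u.proj u.snd X Y := by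
  rw [xi_eq_smul_slopeLift, eta_eq_smul_slopeLift,
    hg.sectional_completeLift_smul_smul (by simp) (by simp), hg.sectional_slopeLift _ _ hXY]
  ring

theorem sectional_eta_eta (hg : IsPseudoRiemannianMetric I M g) (hXY : g u.proj X Y = 0) :
    sectional (completeLift g) u (eta g u X) (eta g u Y) =
      1 / 4 * nablaSectional g u.proj u.snd X Y - sectional g u.proj X Y := by
  rw [eta_eq_smul_slopeLift, eta_eq_smul_slopeLift,
    hg.sectional_completeLift_smul_smul (by simp) (by simp), hg.sectional_slopeLift _ _ hXY]
  ring

theorem sectional_xi_eta_self (hg : IsPseudoRiemannianMetric I M g) (X : TangentSpace I u.proj) :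
    sectional (completeLift g) u (xi g u X) (eta g u X) = 0 := by
  rw [xi_eq_smul_slopeLift, eta_eq_smul_slopeLift,
    hg.sectional_completeLift_smul_smul (by simp) (by simp), hg.sectional_slopeLift_self]

theorem sectional_eta_xi_self (hg : IsPseudoRiemannianMetric I M g) (X : TangentSpace I u.proj) :
    sectional (completeLift g) u (eta g u X) (xi g u X) = 0 := by
  rw [xi_eq_smul_slopeLift, eta_eq_smul_slopeLift,
    hg.sectional_completeLift_smul_smul (by simp) (by simp), hg.sectional_slopeLift_self]

end IsPseudoRiemannianMetric

end SlopeLift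

section Holomorphic

variable {V ι : Type*} [AddCommGroup V] [Module ℝ V] [TopologicalSpace V]

theorem isHolomorphic_span_pair_iff {f : ι → V} (hf : LinearIndependent ℝ f) {L : V →L[ℝ] V}
    {σ : ι → ι} (hσ : Function.Involutive σ) (hfix : ∀ i, σ i ≠ i)
    (hL : ∀ i, L (f i) = f (σ i) ∨ L (f i) = -f (σ i)) (i j : ι) :
    IsHolomorphic L (Submodule.span ℝ {f i, f j}) ↔ σ i = j := by
  have hmem (β : Submodule ℝ V) (k : ι) : L (f k) ∈ β ↔ f (σ k) ∈ β := by
    rcases hL k with h | h <;> simp [h]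
  constructor
  · intro h
    have hspan : f (σ i) ∈ Submodule.span ℝ (f '' {i, j}) := by
      rw [Set.image_pair, ← hmem, ← h]
      exact Submodule.mem_map_of_mem (Submodule.subset_span (Set.mem_insert _ _))
    have hpair : σ i ∈ ({i, j} : Set ι) := by
      by_contra hnot
      exact hf.notMem_span_image hnot hspan
    exact hpair.resolve_left (hfix i)
  · rintro rfl
    set β := Submodule.span ℝ {f i, f (σ i)}
    have hi : f i ∈ β := Submodule.subset_span (by simp)
    have hσi : f (σ i) ∈ β := Submodule.subset_span (by simp)
    apply le_antisymm
    · rw [Submodule.map_span, Submodule.span_le, Set.image_pair, Set.pair_subset_iff]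
      exact ⟨(hmem β i).2 hσi, (hmem β (σ i)).2 ((hσ i).symm ▸ hi)⟩
    · rw [Submodule.span_le, Set.pair_subset_iff]
      have himage (k : ι) (hk : f k ∈ β) : f (σ k) ∈ β.map (L : V →ₗ[ℝ] V) :=
        (hmem _ k).1 (Submodule.mem_map_of_mem hk)
      exact ⟨hσ i ▸ himage (σ i) hσi, himage i hi⟩

end Holomorphic

section Adapted

variable {E : Type*} [NormedAddCommGroup E] [NormedSpace ℝ E]
  {H : Type*} [TopologicalSpace H] {I : ModelWithCorners ℝ E H}
  {M : Type*} [TopologicalSpace M] [ChartedSpace H M]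
  {J : EndField I M} {g : FormField I M} {u : TangentBundle I M} {n : ℕ}
  {e : Module.Basis (Fin n ⊕ Fin n) ℝ (TangentSpace I u.proj)}

/-- The involution `ξ_a ↔ η_ā` of the indices of the adapted basis, induced by `J₁`. -/
def barSwap (A : (Fin n ⊕ Fin n) ⊕ (Fin n ⊕ Fin n)) : (Fin n ⊕ Fin n) ⊕ (Fin n ⊕ Fin n) :=
  (A.map Sum.swap Sum.swap).swap

theorem J₂_adapted [IsManifold I 1 M] (g : FormField I M) (u : TangentBundle I M)
    (e : Module.Basis (Fin n ⊕ Fin n) ℝ (TangentSpace I u.proj))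
    (A : (Fin n ⊕ Fin n) ⊕ (Fin n ⊕ Fin n)) :
    J₂ g u (adapted g u e A) = adapted g u e A.swap ∨
      J₂ g u (adapted g u e A) = -adapted g u e A.swap := by
  rcases A with a | a
  · exact Or.inr (J₂_xi g u (e a))
  · exact Or.inl (J₂_eta g u (e a))

namespace IsOrthonormalJBasis

theorem apply_self_ne_zero (he : IsOrthonormalJBasis J g u.proj e) (a : Fin n ⊕ Fin n) :
    g u.proj (e a) (e a) ≠ 0 := by
  rcases he.normalized a with h | h <;> rw [h] <;> norm_num

theorem J_apply (he : IsOrthonormalJBasis J g u.proj e)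
    (hJ : ∀ v, J u.proj (J u.proj v) = -v) (a : Fin n ⊕ Fin n) :
    J u.proj (e a) = e a.swap ∨ J u.proj (e a) = -e a.swap := by
  rcases a with i | i
  · exact Or.inl (he.bar i).symm
  · exact Or.inr (by rw [he.bar i, hJ, Sum.swap_inr])

section

variable [IsManifold I 1 M]

theorem completeLift_adapted_of_ne (he : IsOrthonormalJBasis J g u.proj e)
    {A B : (Fin n ⊕ Fin n) ⊕ (Fin n ⊕ Fin n)} (hAB : A ≠ B) :
    completeLift g u (adapted g u e A) (adapted g u e B) = 0 := by
  rcases A with a | a <;> rcases B with b | b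
  · exact (completeLift_xi_xi g u _ _).trans (he.orthogonal a b (hAB <| congrArg Sum.inl ·))
  · exact completeLift_xi_eta g u _ _
  · exact completeLift_eta_xi g u _ _
  · exact (completeLift_eta_eta g u _ _).trans
      (neg_eq_zero.2 (he.orthogonal a b (hAB <| congrArg Sum.inr ·)))

theorem completeLift_adapted_self_ne_zero (he : IsOrthonormalJBasis J g u.proj e)
    (A : (Fin n ⊕ Fin n) ⊕ (Fin n ⊕ Fin n)) :
    completeLift g u (adapted g u e A) (adapted g u e A) ≠ 0 := by
  rcases A with a | a
  · exact (completeLift_xi_xi g u _ _).trans_ne (he.apply_self_ne_zero a)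
  · exact (completeLift_eta_eta g u _ _).trans_ne (neg_ne_zero.2 (he.apply_self_ne_zero a))

theorem linearIndependent_adapted (he : IsOrthonormalJBasis J g u.proj e) :
    LinearIndependent ℝ (adapted g u e) :=
  LinearMap.linearIndependent_of_isOrthoᵢ (B := (completeLift g u).toLinearMap₁₂)
    (fun _ _ h => he.completeLift_adapted_of_ne h) he.completeLift_adapted_self_ne_zero

theorem gram_adapted_ne_zero (he : IsOrthonormalJBasis J g u.proj e)
    {A B : (Fin n ⊕ Fin n) ⊕ (Fin n ⊕ Fin n)} (hAB : A ≠ B) :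
    gram (completeLift g) u (adapted g u e A) (adapted g u e B) ≠ 0 := by
  rw [gram, he.completeLift_adapted_of_ne hAB, zero_mul, sub_zero]
  exact mul_ne_zero (he.completeLift_adapted_self_ne_zero B)
    (he.completeLift_adapted_self_ne_zero A)

theorem J₁_adapted (he : IsOrthonormalJBasis J g u.proj e)
    (hJ : ∀ v, J u.proj (J u.proj v) = -v) (A : (Fin n ⊕ Fin n) ⊕ (Fin n ⊕ Fin n)) :
    J₁ J g u (adapted g u e A) = adapted g u e (barSwap A) ∨
      J₁ J g u (adapted g u e A) = -adapted g u e (barSwap A) := by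
  rcases A with a | a
  · change J₁ J g u (xi g u (e a)) = eta g u (e a.swap) ∨
      J₁ J g u (xi g u (e a)) = -eta g u (e a.swap)
    rcases he.J_apply hJ a with h | h <;> simp [J₁_xi, h, eta_neg]
  · change J₁ J g u (eta g u (e a)) = xi g u (e a.swap) ∨
      J₁ J g u (eta g u (e a)) = -xi g u (e a.swap)
    rcases he.J_apply hJ a with h | h <;> simp [J₁_eta, h, xi_neg]

theorem isHolomorphic_J₁_basicPlane_iff (he : IsOrthonormalJBasis J g u.proj e)
    (hJ : ∀ v, J u.proj (J u.proj v) = -v) (A B : (Fin n ⊕ Fin n) ⊕ (Fin n ⊕ Fin n)) :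
    IsHolomorphic (J₁ J g u) (basicPlane g u e A B) ↔
      ∃ i, s(A, B) = s(Sum.inl (Sum.inr i), Sum.inr (Sum.inl i)) ∨
        s(A, B) = s(Sum.inr (Sum.inr i), Sum.inl (Sum.inl i)) := by
  have hinvolutive : Function.Involutive (barSwap (n := n)) := by
    rintro ((i | i) | (i | i)) <;> rfl
  have hfix (A : (Fin n ⊕ Fin n) ⊕ (Fin n ⊕ Fin n)) : barSwap A ≠ A := by
    rcases A with a | a <;> simp [barSwap]
  rw [basicPlane, isHolomorphic_span_pair_iff he.linearIndependent_adapted hinvolutive hfix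
    (he.J₁_adapted hJ)]
  rcases A with (i | i) | (i | i) <;> rcases B with (j | j) | (j | j) <;>
    simp [barSwap, eq_comm]

theorem isHolomorphic_J₂_basicPlane_iff (he : IsOrthonormalJBasis J g u.proj e)
    (A B : (Fin n ⊕ Fin n) ⊕ (Fin n ⊕ Fin n)) :
    IsHolomorphic (J₂ g u) (basicPlane g u e A B) ↔ ∃ a, s(A, B) = s(Sum.inr a, Sum.inl a) := by
  have hfix (A : (Fin n ⊕ Fin n) ⊕ (Fin n ⊕ Fin n)) : A.swap ≠ A := by rcases A with a | a <;> simp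
  rw [basicPlane, isHolomorphic_span_pair_iff he.linearIndependent_adapted Sum.swap_swap hfix
    (J₂_adapted g u e)]
  rcases A with a | a <;> rcases B with b | b <;> simp [eq_comm]

end

theorem sectional_eq_zero_of_isHolomorphic_J₂ [IsManifold I ∞ M] [I.Boundaryless]
    [FiniteDimensional ℝ E] (he : IsOrthonormalJBasis J g u.proj e)
    (hg : IsPseudoRiemannianMetric I M g) {A B : (Fin n ⊕ Fin n) ⊕ (Fin n ⊕ Fin n)}
    (hAB : IsHolomorphic (J₂ g u) (basicPlane g u e A B)) :
    sectional (completeLift g) u (adapted g u e A) (adapted g u e B) = 0 := by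
  obtain ⟨a, ha⟩ := (he.isHolomorphic_J₂_basicPlane_iff A B).1 hAB
  obtain ⟨rfl, rfl⟩ | ⟨rfl, rfl⟩ := Sym2.eq_iff.1 ha
  · exact hg.sectional_eta_xi_self (e a)
  · exact hg.sectional_xi_eta_self (e a)

end IsOrthonormalJBasis

end Adapted

end Norden

end

theorem mainTheorem11_general
    {E : Type*} [NormedAddCommGroup E] [NormedSpace ℝ E] [FiniteDimensional ℝ E]
    {H : Type*} [TopologicalSpace H] (I : ModelWithCorners ℝ E H) [I.Boundaryless]
    {M : Type*} [TopologicalSpace M] [ChartedSpace H M] [IsManifold I ∞ M]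
    (J : Norden.EndField I M) (g : Norden.FormField I M)
    (hg : Norden.IsPseudoRiemannianMetric I M g) (u : TangentBundle I M)
    (hJ : ∀ v, J u.proj (J u.proj v) = -v) {n : ℕ}
    (e : Module.Basis (Fin n ⊕ Fin n) ℝ (TangentSpace I u.proj))
    (he : Norden.IsOrthonormalJBasis J g u.proj e) :
    (∀ A B, A ≠ B →
      Norden.gram (Norden.completeLift g) u
        (Norden.adapted g u e A) (Norden.adapted g u e B) ≠ 0) ∧
    (∀ a b, a ≠ b →
      Norden.sectional (Norden.completeLift g) u (Norden.xi g u (e a)) (Norden.xi g u (e b)) =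
        1 / 4 * Norden.nablaSectional g u.proj u.snd (e a) (e b)
          + Norden.sectional g u.proj (e a) (e b) ∧
      Norden.sectional (Norden.completeLift g) u (Norden.xi g u (e a)) (Norden.eta g u (e b)) =
        -(1 / 4) * Norden.nablaSectional g u.proj u.snd (e a) (e b) ∧
      Norden.sectional (Norden.completeLift g) u (Norden.eta g u (e a)) (Norden.eta g u (e b)) =
        1 / 4 * Norden.nablaSectional g u.proj u.snd (e a) (e b)
          - Norden.sectional g u.proj (e a) (e b)) ∧
    (∀ A B, A ≠ B →
      (Norden.IsHolomorphic (Norden.J₁ J g u) (Norden.basicPlane g u e A B) ↔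
        ∃ i, s(A, B) = s(Sum.inl (Sum.inr i), Sum.inr (Sum.inl i)) ∨
          s(A, B) = s(Sum.inr (Sum.inr i), Sum.inl (Sum.inl i)))) ∧
    (∀ i,
      Norden.sectional (Norden.completeLift g) u
          (Norden.xi g u (e (Sum.inr i))) (Norden.eta g u (e (Sum.inl i))) =
        Norden.sectional (Norden.completeLift g) u
          (Norden.eta g u (e (Sum.inr i))) (Norden.xi g u (e (Sum.inl i)))) ∧
    (∀ A B, A ≠ B →
      (Norden.IsHolomorphic (Norden.J₂ g u) (Norden.basicPlane g u e A B) ↔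
        ∃ a, s(A, B) = s(Sum.inr a, Sum.inl a))) ∧
    (∀ A B, A ≠ B →
      Norden.IsHolomorphic (Norden.J₂ g u) (Norden.basicPlane g u e A B) →
        Norden.sectional (Norden.completeLift g) u
          (Norden.adapted g u e A) (Norden.adapted g u e B) = 0) := by
  refine ⟨fun A B hAB => he.gram_adapted_ne_zero hAB, fun a b hab => ?_,
    fun A B _ => he.isHolomorphic_J₁_basicPlane_iff hJ A B, fun i => ?_,
    fun A B _ => he.isHolomorphic_J₂_basicPlane_iff A B, fun A B _ hAB => ?_⟩
  · have horth := he.orthogonal a b hab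
    exact ⟨hg.sectional_xi_xi horth, hg.sectional_xi_eta horth, hg.sectional_eta_eta horth⟩
  · have horth := he.orthogonal (.inr i) (.inl i) Sum.inr_ne_inl
    rw [hg.sectional_xi_eta horth, hg.sectional_eta_xi horth]
  · exact he.sectional_eq_zero_of_isHolomorphic_J₂ hg hAB

theorem mainTheorem11
    {E : Type*} [NormedAddCommGroup E] [NormedSpace ℝ E] [FiniteDimensional ℝ E]
    {H : Type*} [TopologicalSpace H] (I : ModelWithCorners ℝ E H) [I.Boundaryless]
    {M : Type*} [TopologicalSpace M] [ChartedSpace H M] [IsManifold I ∞ M]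
    (J : Norden.EndField I M) (g : Norden.FormField I M) (hM : Norden.IsAlmostNorden I M J g)
    (u : TangentBundle I M) {n : ℕ}
    (e : Module.Basis (Fin n ⊕ Fin n) ℝ (TangentSpace I u.proj))
    (he : Norden.IsOrthonormalJBasis J g u.proj e) :
    -- every basic 2-plane is non-degenerate
    (∀ A B, A ≠ B →
      Norden.gram (Norden.completeLift g) u
        (Norden.adapted g u e A) (Norden.adapted g u e B) ≠ 0) ∧
    -- the sectional curvatures of the basic 2-planes in terms of `k` and `∇_u k`
    (∀ a b, a ≠ b →
      Norden.sectional (Norden.completeLift g) u (Norden.xi g u (e a)) (Norden.xi g u (e b)) =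
        1 / 4 * Norden.nablaSectional g u.proj u.snd (e a) (e b)
          + Norden.sectional g u.proj (e a) (e b) ∧
      Norden.sectional (Norden.completeLift g) u (Norden.xi g u (e a)) (Norden.eta g u (e b)) =
        -(1 / 4) * Norden.nablaSectional g u.proj u.snd (e a) (e b) ∧
      Norden.sectional (Norden.completeLift g) u (Norden.eta g u (e a)) (Norden.eta g u (e b)) =
        1 / 4 * Norden.nablaSectional g u.proj u.snd (e a) (e b)
          - Norden.sectional g u.proj (e a) (e b)) ∧
    -- the `J₁`-holomorphic basic 2-planes are `{ξ_ī, η_i}` and `{η_ī, ξ_i}`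
    (∀ A B, A ≠ B →
      (Norden.IsHolomorphic (Norden.J₁ J g u) (Norden.basicPlane g u e A B) ↔
        ∃ i, s(A, B) = s(Sum.inl (Sum.inr i), Sum.inr (Sum.inl i)) ∨
          s(A, B) = s(Sum.inr (Sum.inr i), Sum.inl (Sum.inl i)))) ∧
    -- and their sectional curvatures are equal
    (∀ i,
      Norden.sectional (Norden.completeLift g) u
          (Norden.xi g u (e (Sum.inr i))) (Norden.eta g u (e (Sum.inl i))) =
        Norden.sectional (Norden.completeLift g) u
          (Norden.eta g u (e (Sum.inr i))) (Norden.xi g u (e (Sum.inl i)))) ∧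
    -- the `J₂`-holomorphic basic 2-planes are `{η_i, ξ_i}` and `{η_ī, ξ_ī}`
    (∀ A B, A ≠ B →
      (Norden.IsHolomorphic (Norden.J₂ g u) (Norden.basicPlane g u e A B) ↔
        ∃ a, s(A, B) = s(Sum.inr a, Sum.inl a))) ∧
    -- and their sectional curvatures vanish
    (∀ A B, A ≠ B →
      Norden.IsHolomorphic (Norden.J₂ g u) (Norden.basicPlane g u e A B) →
        Norden.sectional (Norden.completeLift g) u
          (Norden.adapted g u e A) (Norden.adapted g u e B) = 0) := by
  exact mainTheorem11_general I J g hM.metric u (hM.almostComplex.sq u.proj) e he
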